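/- All graphs are finite and may have loops and parallel edges. A sequence is \emph{nonrepetitive} if no block of consecutive terms in it has the form $s_1,\dots,s_r,s_1,\dots,s_r$ with $r\ge 1$. A \emph{plane graph} is a graph embedded in the plane without crossings; it is \emph{outerplane} if all its vertices are incident to the outer face. A \emph{facial walk} of a plane graph is a closed walk $v_0,\dots,v_{\ell-1}$ in which, for every $i$, the edges $v_{i-1}v_i$ and $v_iv_{i+1}$ (indices modulo $\ell$) are consecutive in the counterclockwise cyclic order of the edges at $v_i$. A \emph{facial path} is a contiguous subsequence of a facial walk (of the outer face or of an inner face) whose vertices are distinct. A \emph{facial nonrepetitive $k$-colouring} assigns to every vertex one of $k$ colours so that the colour sequence of every facial path is nonrepetitive. A \emph{2-connected component} of $G$ is a maximal set of vertices that induces a subgraph with more than two vertices and without a vertex cut of size less than two. A \emph{blocking set} of an outerplane graph $G$ is a set $B\subseteq V(G)$ such that $H-B$ is a tree for each 2-connected component $H$ of $G$, and $V(F)\setminus B\neq\emptyset$ for each inner face $F$ of $G$. The \emph{blocking graph} $\mathrm{block}_B(G)$ is the plane graph with vertex set $B$ obtained as follows: delete all vertices not in $B$ from the closed facial walk on the outer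 face of $G$ (from each such walk, if $G$ is disconnected) to obtain a cyclic sequence of vertices of $B$, and for each pair $u,w$ of consecutive elements of this sequence add an edge $uw$, drawn in the outer face of $G$ along the corresponding part of the walk (so loops and parallel edges may occur). \textbf{Lemma.} Let $G$ be an outerplane graph, let $B$ be a blocking set of $G$, and let $k\ge 0$ be an integer. If $\mathrm{block}_B(G)$ has a facial nonrepetitive $k$-colouring, then $G$ has a facial nonrepetitive $(k+4)$-colouring. -/

import Mathlib

/-! ## Nonrepetitive sequences -/

/-- A sequence is nonrepetitive if no block (contiguous subsequence) of it is a repetition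
`s₁, …, s_r, s₁, …, s_r` with `r ≥ 1`. -/
def Nonrepetitive {α : Type*} (l : List α) : Prop :=
  ∀ w : List α, w ≠ [] → ¬ (w ++ w) <:+: l

/-! ## First-return permutation -/

section FirstReturn

variable {α : Type*} [Finite α]

theorem firstReturn_exists (f : Equiv.Perm α) (p : α → Prop) (x : {x // p x}) :
    ∃ k : ℕ, p ((f ^ (k + 1)) x) := by
  refine ⟨orderOf f - 1, ?_⟩
  rw [Nat.sub_add_cancel (orderOf_pos f), pow_orderOf_eq_one]
  exact x.2

open Classical in
/-- The first of `f x, f (f x), …` that satisfies `p`. -/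
noncomputable def firstReturnFun (f : Equiv.Perm α) (p : α → Prop) (x : {x // p x}) :
    {x // p x} :=
  ⟨(f ^ (Nat.find (firstReturn_exists f p x) + 1)) x, Nat.find_spec (firstReturn_exists f p x)⟩

theorem firstReturnFun_spec (f : Equiv.Perm α) (p : α → Prop) (x : {x // p x}) :
    ∃ k : ℕ, (firstReturnFun f p x : α) = (f ^ (k + 1)) x ∧
      ∀ j < k, ¬ p ((f ^ (j + 1)) x) := by
  classical
  exact ⟨Nat.find (firstReturn_exists f p x), rfl,
    fun j hj => Nat.find_min (firstReturn_exists f p x) hj⟩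

theorem firstReturnFun_inv (f : Equiv.Perm α) (p : α → Prop) (x : {x // p x}) :
    firstReturnFun f⁻¹ p (firstReturnFun f p x) = x := by
  obtain ⟨k, hk, hk'⟩ := firstReturnFun_spec f p x
  obtain ⟨m, hm, hm'⟩ := firstReturnFun_spec f⁻¹ p (firstReturnFun f p x)
  have key : ∀ j ≤ k, (f⁻¹ ^ (j + 1)) (firstReturnFun f p x : α) = (f ^ (k - j)) x := by
    intro j hj
    rw [hk, inv_pow, Equiv.Perm.inv_eq_iff_eq, ← Equiv.Perm.mul_apply, ← pow_add]
    congr 2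
    omega
  apply Subtype.ext
  rcases lt_trichotomy m k with h | h | h
  · exfalso
    have h1 := key m h.le
    have h2 := hk' (k - m - 1) (by omega)
    rw [show k - m - 1 + 1 = k - m by omega, ← h1, ← hm] at h2
    exact h2 (Subtype.property _)
  · rw [hm, key m h.le, h]
    simp
  · exfalso
    have h1 := key k le_rfl
    have h2 := hm' k h
    rw [h1] at h2
    exact h2 (by simpa using x.2)

/-- The permutation that a permutation `f` induces on a subset by following `f` until it first
returns to the subset; that is, delete from the cycles of `f` everything outside the subset. -/
noncomputable def firstReturn (f : Equiv.Perm α) (p : α → Prop) : Equiv.Perm {x // p x} where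
  toFun := firstReturnFun f p
  invFun := firstReturnFun f⁻¹ p
  left_inv := firstReturnFun_inv f p
  right_inv x := by simpa using firstReturnFun_inv f⁻¹ p x

theorem firstReturn_sameCycle_apply (f : Equiv.Perm α) (p : α → Prop) (x : {x // p x}) :
    f.SameCycle x (firstReturn f p x) := by
  obtain ⟨k, hk, -⟩ := firstReturnFun_spec f p x
  exact ⟨(k + 1 : ℕ), by rw [zpow_natCast]; exact hk.symm⟩

theorem firstReturn_sameCycle (f : Equiv.Perm α) (p : α → Prop) (x y : {x // p x}) :
    (firstReturn f p).SameCycle x y ↔ f.SameCycle x y := by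
  constructor
  · rintro h
    obtain ⟨i, -, rfl⟩ := h.exists_pow_eq'
    clear h
    induction i with
    | zero => exact Equiv.Perm.SameCycle.refl _ _
    | succ n ih =>
      rw [pow_succ', Equiv.Perm.mul_apply]
      exact ih.trans (firstReturn_sameCycle_apply f p _)
  · intro h
    obtain ⟨i, -, hi⟩ := h.exists_pow_eq'
    clear h
    induction i using Nat.strong_induction_on generalizing x with
    | _ i ih =>
      rcases Nat.eq_zero_or_pos i with rfl | hpos
      · have : x = y := Subtype.ext (by simpa using hi)
        exact this ▸ Equiv.Perm.SameCycle.refl _ _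
      · obtain ⟨k, hk, hk'⟩ := firstReturnFun_spec f p x
        have hle : k + 1 ≤ i := by
          by_contra hlt
          refine hk' (i - 1) (by omega) ?_
          rw [Nat.sub_add_cancel hpos, hi]
          exact y.2
        have := ih (i - (k + 1)) (by omega) (firstReturn f p x) (by
          change (f ^ (i - (k + 1))) (firstReturnFun f p x : α) = y
          rw [hk, ← Equiv.Perm.mul_apply, ← pow_add, Nat.sub_add_cancel hle, hi])
        exact (Equiv.Perm.sameCycle_apply_left).1 this

end FirstReturn

/-! ## Embedded multigraphs -/

/-- A multigraph (loops and parallel edges allowed) with vertex set `V`, embedded in an oriented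
surface and given by its rotation system. `D` is the set of darts (edges with a direction):
every edge, loops included, consists of two darts that are exchanged by `reverse`, and
`rotation` sends a dart to the next dart, in counterclockwise order, with the same starting
vertex. Vertices without darts are isolated vertices. The set `outer` marks the
darts that run along the boundary of the outer face; it is a union of facial walks. -/
structure EmbeddedGraph (V D : Type*) where
  /-- the starting vertex of a dart -/
  tail : D → V
  /-- the same edge in the opposite direction -/
  reverse : Equiv.Perm D
  /-- counterclockwise successor around the starting vertex -/
  rotation : Equiv.Perm D
  reverse_reverse : ∀ d, reverse (reverse d) = d
  reverse_ne : ∀ d, reverse d ≠ d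
  tail_eq_iff : ∀ d e, tail d = tail e ↔ rotation.SameCycle d e
  /-- the darts on the boundary of the outer face -/
  outer : Set D
  outer_iff : ∀ d, rotation (reverse d) ∈ outer ↔ d ∈ outer

namespace EmbeddedGraph

variable {V D : Type*}

/-- The end vertex of a dart. -/
def head (G : EmbeddedGraph V D) (d : D) : V := G.tail (G.reverse d)

/-- The successor of a dart `uv` on its facial walk: the dart `vw` such that the edges `uv` and
`vw` are consecutive in the counterclockwise order around `v`. The facial walks are the cycles
of this permutation. -/
def faceNext (G : EmbeddedGraph V D) : Equiv.Perm D := G.rotation * G.reverse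

/-- The simple graph that underlies the multigraph (forget loops and multiplicities). -/
def toSimpleGraph (G : EmbeddedGraph V D) : SimpleGraph V where
  Adj u v := u ≠ v ∧ ∃ d, G.tail d = u ∧ G.head d = v
  symm := by
    constructor
    rintro u v ⟨h, d, rfl, rfl⟩
    exact ⟨h.symm, G.reverse d, rfl, by simp [head, G.reverse_reverse]⟩
  loopless := ⟨fun _ h => h.1 rfl⟩

/-- A facial path: a contiguous part of a facial walk, as a sequence of vertices, in which
all vertices are distinct. -/
def IsFacialPath (G : EmbeddedGraph V D) (l : List V) : Prop :=
  l.Nodup ∧ ∃ (d : D) (n : ℕ), l = (List.iterate G.faceNext d n).map G.tail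

/-- A facial nonrepetitive colouring: the colour sequence of every facial path, on the outer face
or on an inner face, is nonrepetitive. -/
def IsFacialNonrepetitive {C : Type*} (G : EmbeddedGraph V D) (c : V → C) : Prop :=
  ∀ l, G.IsFacialPath l → Nonrepetitive (l.map c)

/-- The number of cycles of a permutation, fixed points included. -/
noncomputable def numCycles (f : Equiv.Perm D) : ℕ :=
  Nat.card (Quotient (Equiv.Perm.SameCycle.setoid f))

/-- Every connected component is embedded in the sphere. By Euler's formula each component with
`v` vertices, `e` edges and `f` facial walks (an isolated vertex has one, of length zero)
satisfies `v + f ≤ e + 2`, with equality if and only if its surface is the sphere, so it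
suffices to compare the sums over all components. -/
def IsPlanar (G : EmbeddedGraph V D) : Prop :=
  Nat.card V + (numCycles G.faceNext + Nat.card {v : V // ∀ d, G.tail d ≠ v}) =
    numCycles G.reverse + 2 * Nat.card G.toSimpleGraph.ConnectedComponent

/-- An outerplane graph: a graph embedded in the plane such that all vertices are incident to the
outer face. As no component can then lie inside an inner face of another one, such an
embedding consists of a planar embedding of each component together with the choice, for each
component that has an edge, of one facial walk along the outer face. -/
structure IsOuterplane (G : EmbeddedGraph V D) : Prop where
  planar : G.IsPlanar
  /-- every vertex (unless isolated) is incident to the outer face -/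
  incident_outer : ∀ d, ∃ e ∈ G.outer, G.tail e = G.tail d
  /-- the outer face has one boundary walk in each component -/
  outer_unique : ∀ d ∈ G.outer, ∀ e ∈ G.outer,
    G.toSimpleGraph.Reachable (G.tail d) (G.tail e) → G.faceNext.SameCycle d e

/-- The subgraph induced by `S` is 2-connected: it has more than two vertices and no
vertex cut of size less than two. -/
def IsTwoConnectedOn (G : EmbeddedGraph V D) (S : Set V) : Prop :=
  2 < S.ncard ∧ ∀ T ⊆ S, T.ncard < 2 → (G.toSimpleGraph.induce (S \ T)).Connected

/-- A 2-connected component: a maximal set of vertices that induces a 2-connected subgraph. -/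
def IsTwoConnectedComponent (G : EmbeddedGraph V D) (S : Set V) : Prop :=
  Maximal G.IsTwoConnectedOn S

/-- The submultigraph induced by `S` is a tree: connected, and without cycles, where loops are
cycles of length one and pairs of parallel edges are cycles of length two. -/
def IsTreeOn (G : EmbeddedGraph V D) (S : Set V) : Prop :=
  (G.toSimpleGraph.induce S).IsTree ∧
  (∀ d, G.tail d ∈ S → G.head d ≠ G.tail d) ∧
  (∀ d e, G.tail d ∈ S → G.head d ∈ S → G.tail d = G.tail e → G.head d = G.head e → d = e)

/-- A blocking set of an outerplane graph: `H - B` is a tree for every 2-connected component `H`,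
and every inner face has a vertex outside `B`. -/
def IsBlockingSet (G : EmbeddedGraph V D) (B : Set V) : Prop :=
  (∀ H, G.IsTwoConnectedComponent H → G.IsTreeOn (H \ B)) ∧
  (∀ d ∉ G.outer, ∃ e, G.faceNext.SameCycle d e ∧ G.tail e ∉ B)

/-! ### The blocking graph -/

section Blocking

variable [Finite D] (G : EmbeddedGraph V D) (B : Set V)

/-- The occurrences of vertices of `B` on the outer facial walk(s): the outer dart `d` stands for
the visit of the walk to `tail d` (the corner between the dart before `d` and `d`). -/
def Corner (d : D) : Prop := d ∈ G.outer ∧ G.tail d ∈ B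

/-- The next visit of the outer walk to a vertex of `B`: the cyclic sequence obtained from
the outer walk by removing the vertices outside `B`. -/
noncomputable def nextCorner : Equiv.Perm {d // G.Corner B d} := firstReturn G.faceNext (G.Corner B)

/-- The next outer corner at the same vertex, in counterclockwise order. -/
noncomputable def turnCorner : Equiv.Perm {d // G.Corner B d} := firstReturn G.rotation (G.Corner B)

theorem tail_turnCorner (x : {d // G.Corner B d}) :
    G.tail (G.turnCorner B x) = G.tail x :=
  ((G.tail_eq_iff _ _).2 (firstReturn_sameCycle_apply _ _ x)).symm

/-- The rotation of the blocking graph. Each corner `x` gives one edge, from `tail x` to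
`tail (nextCorner x)`, with the darts `(x, true)` in this and `(x, false)` in the opposite
direction, drawn in the outer face along the outer walk. So within the corner `x` the end of the
edge that arrives, `(nextCorner⁻¹ x, false)`, is followed by the start `(x, true)` of the edge
that leaves, and after this comes the arriving edge of the next corner at the same vertex. -/
noncomputable def blockRotation : Equiv.Perm ({d // G.Corner B d} × Bool) where
  toFun
    | (x, true) => ((G.nextCorner B).symm (G.turnCorner B x), false)
    | (x, false) => (G.nextCorner B x, true)
  invFun
    | (x, true) => ((G.nextCorner B).symm x, false)
    | (x, false) => ((G.turnCorner B).symm (G.nextCorner B x), true)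
  left_inv := by rintro ⟨x, _ | _⟩ <;> simp
  right_inv := by rintro ⟨x, _ | _⟩ <;> simp

/-- The starting vertex of a dart of the blocking graph. -/
noncomputable def blockTail : {d // G.Corner B d} × Bool → B
  | (x, true) => ⟨G.tail x, x.2.2⟩
  | (x, false) => ⟨G.tail (G.nextCorner B x), (G.nextCorner B x).2.2⟩

theorem blockTail_rotation (d : {d // G.Corner B d} × Bool) :
    G.blockTail B (G.blockRotation B d) = G.blockTail B d := by
  obtain ⟨x, _ | _⟩ := d
  · rfl
  · apply Subtype.ext
    simp [blockRotation, blockTail, tail_turnCorner]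

theorem blockTail_eq_of_sameCycle {d e : {d // G.Corner B d} × Bool}
    (h : (G.blockRotation B).SameCycle d e) : G.blockTail B d = G.blockTail B e := by
  obtain ⟨i, -, rfl⟩ := h.exists_pow_eq'
  clear h
  induction i with
  | zero => rfl
  | succ n ih => rw [pow_succ', Equiv.Perm.mul_apply, blockTail_rotation, ← ih]

theorem blockRotation_sameCycle_turn (x : {d // G.Corner B d}) :
    (G.blockRotation B).SameCycle (x, true) (G.turnCorner B x, true) :=
  ⟨2, by rw [zpow_two, Equiv.Perm.mul_apply]; simp [blockRotation]⟩

theorem blockRotation_sameCycle_of_tail {x y : {d // G.Corner B d}}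
    (h : G.tail x = G.tail y) : (G.blockRotation B).SameCycle (x, true) (y, true) := by
  have h' : (G.turnCorner B).SameCycle x y :=
    (firstReturn_sameCycle _ _ _ _).2 ((G.tail_eq_iff _ _).1 h)
  obtain ⟨i, -, rfl⟩ := h'.exists_pow_eq'
  clear h h'
  induction i with
  | zero => exact Equiv.Perm.SameCycle.refl _ _
  | succ n ih =>
    rw [pow_succ', Equiv.Perm.mul_apply]
    exact ih.trans (G.blockRotation_sameCycle_turn B _)

theorem blockRotation_exists_out (d : {d // G.Corner B d} × Bool) :
    ∃ x, (G.blockRotation B).SameCycle d (x, true) := by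
  obtain ⟨x, _ | _⟩ := d
  · exact ⟨G.nextCorner B x, 1, by simp [blockRotation]⟩
  · exact ⟨x, Equiv.Perm.SameCycle.refl _ _⟩

/-- The blocking graph of `G` for `B`, embedded: its vertex set is `B`, each two consecutive
elements `u, w` of the cyclic sequence that remains of the outer walk after the vertices outside
`B` are removed give an edge `uw` (so there may be loops and parallel edges), and the edges are
drawn in the outer face of `G`, along the outer walk. Its outer facial walk is that sequence. -/
noncomputable def blockingGraph : EmbeddedGraph B ({d // G.Corner B d} × Bool) where
  tail := G.blockTail B
  reverse := (Equiv.refl _).prodCongr Equiv.boolNot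
  rotation := G.blockRotation B
  reverse_reverse := by rintro ⟨x, _ | _⟩ <;> rfl
  reverse_ne := by rintro ⟨x, _ | _⟩ <;> simp
  tail_eq_iff d e := by
    refine ⟨fun h => ?_, G.blockTail_eq_of_sameCycle B⟩
    obtain ⟨x, hx⟩ := G.blockRotation_exists_out B d
    obtain ⟨y, hy⟩ := G.blockRotation_exists_out B e
    have h' : G.blockTail B (x, true) = G.blockTail B (y, true) := by
      rw [← G.blockTail_eq_of_sameCycle B hx, h, G.blockTail_eq_of_sameCycle B hy]
    exact (hx.trans (G.blockRotation_sameCycle_of_tail B (congrArg Subtype.val h'))).trans hy.symm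
  outer := {d | d.2 = true}
  outer_iff := by rintro ⟨x, _ | _⟩ <;> simp [blockRotation]

end Blocking

end EmbeddedGraph

/-! ## Nonrepetitive sequences over four letters -/

/-! Keep the given colours on `B` and give the other vertices four new colours. The vertices of a
cycle induce a 2-connected subgraph, and `H - B` is a tree for every 2-connected component `H`;
hence `G - B` is a forest. Colouring a rooted forest by depth, through a square-free sequence over
four letters in which letters at distance two differ, makes all its paths nonrepetitive
(`exists_nonrepetitive_colouring`).

Suppose a facial path v_0, ..., v_{2r-1} is coloured repetitively. The two palettes are disjoint, so
v_j and v_{j+r} agree on membership in `B`. If the path avoids `B`, it lies in the forest. If it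
runs along the outer face, its vertices in `B` form a facial path of the blocking graph whose
colours are still a square. On an inner face, suppose that v_i, v_{i+r} are off `B` and v_j, v_{j+r}
in `B`. The face boundary is 2-connected, so v_i and v_{i+r} are joined off `B`; with the facial
segment between them this gives a closed curve that separates v_j from v_{j+r}, although both are on
the outer face (`false_of_mixed_square`). So the whole path lies in `B`. An edge with both ends in
`B` has the outer face on one side (`reverse_mem_outer`), hence it reappears in the blocking graph,
and the path is again a facial path there.

The Jordan curve arguments are homological. By Euler's formula every 1-cycle mod 2 is the difference
across edges of a function `f` on faces (`IsPlanar.exists_face_function`). On the outer walk of a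
component `f` has a single value, and around a vertex `f` changes in a controlled way; comparing
this value at two vertices replaces the statement that a curve separates them. -/

theorem nonrepetitive_of_forall_window {α : Type*} {l : List α}
    (h : ∀ i r, 0 < r → i + 2 * r ≤ l.length → ∃ j < r, l[i + j]? ≠ l[i + r + j]?) :
    Nonrepetitive l := by
  rintro w hw ⟨s, t, rfl⟩
  have hpos : 0 < w.length := List.length_pos_iff.2 hw
  obtain ⟨j, hj, hne⟩ := h s.length w.length hpos (by simp; omega)
  apply hne
  simp only [List.append_assoc]
  rw [List.getElem?_append_right (by omega), List.getElem?_append_left (by omega),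
    List.getElem?_append_right (by omega), List.getElem?_append_right (by omega),
    List.getElem?_append_left (by omega)]
  congr 1
  omega

/-- The Thue–Morse sequence: the parity of the number of binary digits one. -/
def thueMorse (n : ℕ) : Bool :=
  if n = 0 then false else xor (n % 2 == 1) (thueMorse (n / 2))

theorem thueMorse_two_mul (n : ℕ) : thueMorse (2 * n) = thueMorse n := by
  rcases Nat.eq_zero_or_pos n with rfl | h
  · rfl
  · rw [thueMorse, if_neg (by omega)]
    simp

theorem thueMorse_two_mul_add_one (n : ℕ) : thueMorse (2 * n + 1) = !thueMorse n := by
  rw [thueMorse, if_neg (by omega), show (2 * n + 1) % 2 = 1 by omega,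
    show (2 * n + 1) / 2 = n by omega]
  simp

theorem thueMorse_not_three (n : ℕ) :
    ¬ (thueMorse n = thueMorse (n + 1) ∧ thueMorse (n + 1) = thueMorse (n + 2)) := by
  rintro ⟨h1, h2⟩
  rcases Nat.even_or_odd' n with ⟨m, rfl | rfl⟩
  · rw [thueMorse_two_mul, thueMorse_two_mul_add_one] at h1
    simp at h1
  · rw [show 2 * m + 1 + 1 = 2 * (m + 1) by ring, show 2 * m + 1 + 2 = 2 * (m + 1) + 1 by ring,
      thueMorse_two_mul, thueMorse_two_mul_add_one] at h2
    simp at h2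

/-- The Thue–Morse sequence contains no overlap. -/
theorem thueMorse_overlapFree (p : ℕ) (hp : 0 < p) (i : ℕ) :
    ∃ j ≤ p, thueMorse (i + j) ≠ thueMorse (i + j + p) := by
  induction p using Nat.strong_induction_on generalizing i with
  | _ p ih =>
    by_contra! h
    rcases Nat.even_or_odd' p with ⟨q, rfl | rfl⟩
    -- For an even period the positions of the parity of `i` carry an overlap of half the period, up
    -- to complementation.
    · rcases Nat.even_or_odd' i with ⟨m, rfl | rfl⟩
      · obtain ⟨j, hj, hne⟩ := ih q (by omega) (by omega) m
        have := h (2 * j) (by omega)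
        rw [show 2 * m + 2 * j + 2 * q = 2 * (m + j + q) by ring, ← mul_add, thueMorse_two_mul,
          thueMorse_two_mul] at this
        exact hne this
      · obtain ⟨j, hj, hne⟩ := ih q (by omega) (by omega) m
        have := h (2 * j) (by omega)
        rw [show 2 * m + 1 + 2 * j + 2 * q = 2 * (m + j + q) + 1 by ring,
          show 2 * m + 1 + 2 * j = 2 * (m + j) + 1 by ring, thueMorse_two_mul_add_one,
          thueMorse_two_mul_add_one] at this
        exact hne (by simpa using this)
    · have even_ne : ∀ x, x % 2 = 0 → thueMorse (x + 1) ≠ thueMorse x := by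
        intro x hx
        obtain ⟨y, rfl⟩ : ∃ y, x = 2 * y := ⟨x / 2, by omega⟩
        rw [thueMorse_two_mul, thueMorse_two_mul_add_one]
        simp
      -- For an odd period, shifting by it turns odd positions into even ones, where consecutive
      -- letters always differ. So the whole window alternates.
      have alt : ∀ x, i ≤ x → x < i + 2 * (2 * q + 1) → thueMorse (x + 1) ≠ thueMorse x := by
        intro x hx1 hx2
        rcases Nat.mod_two_eq_zero_or_one x with hx | hx
        · exact even_ne x hx
        · rcases Nat.lt_or_ge x (i + (2 * q + 1)) with hlt | hge
          · have e1 := h (x - i) (by omega)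
            have e2 := h (x + 1 - i) (by omega)
            rw [show i + (x - i) = x by omega] at e1
            rw [show i + (x + 1 - i) = x + 1 by omega] at e2
            rw [e1, e2, show x + 1 + (2 * q + 1) = x + (2 * q + 1) + 1 by ring]
            exact even_ne _ (by omega)
          · have e1 := h (x - (2 * q + 1) - i) (by omega)
            have e2 := h (x + 1 - (2 * q + 1) - i) (by omega)
            rw [show i + (x - (2 * q + 1) - i) = x - (2 * q + 1) by omega,
              show x - (2 * q + 1) + (2 * q + 1) = x by omega] at e1
            rw [show i + (x + 1 - (2 * q + 1) - i) = x - (2 * q + 1) + 1 by omega,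
              show x - (2 * q + 1) + 1 + (2 * q + 1) = x + 1 by omega] at e2
            rw [← e1, ← e2]
            exact even_ne _ (by omega)
      rcases Nat.eq_zero_or_pos q with rfl | hq
      · have e1 := h 0 (by omega)
        have := alt i le_rfl (by omega)
        simp at e1
        exact this e1.symm
      · have two : ∀ x, i ≤ x → x + 2 ≤ i + 2 * (2 * q + 1) →
            thueMorse x = thueMorse (x + 2) := by
          intro x hx1 hx2
          have a1 := alt x hx1 (by omega)
          have a2 := alt (x + 1) (by omega) (by omega)
          revert a1 a2
          rw [show x + 1 + 1 = x + 2 by ring]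
          cases thueMorse x <;> cases thueMorse (x + 1) <;> cases thueMorse (x + 2) <;> simp
        -- Here 2m is the first even position of the window. The equal letters at 2m, 2m + 2, 2m + 4
        -- become three equal consecutive letters at m.
        obtain ⟨m, hm1, hm2⟩ : ∃ m, i ≤ 2 * m ∧ 2 * m ≤ i + 1 := ⟨(i + 1) / 2, by omega, by omega⟩
        have b1 := two (2 * m) hm1 (by omega)
        have b2 := two (2 * m + 2) (by omega) (by omega)
        rw [show 2 * m + 2 + 2 = 2 * (m + 2) by ring, show 2 * m + 2 = 2 * (m + 1) by ring,
          thueMorse_two_mul, thueMorse_two_mul] at b2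
        rw [show 2 * m + 2 = 2 * (m + 1) by ring, thueMorse_two_mul, thueMorse_two_mul] at b1
        exact thueMorse_not_three m ⟨b1, b2⟩

/-- The steps `t (n + 1) - t n ∈ {0, 1, -1}` of the Thue–Morse sequence `t`, encoded by
`0`, `1`, `2`. -/
def thueStep (n : ℕ) : Fin 4 :=
  if thueMorse (n + 1) = thueMorse n then 0 else if thueMorse (n + 1) then 1 else 2

theorem thueStep_ne_three (n : ℕ) : thueStep n ≠ 3 := by
  unfold thueStep
  split_ifs <;> decide

/-- The steps telescope, so a square makes t(i), t(i+r), t(i+2r) an arithmetic progression in {0,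
1}. It is constant, and the square becomes an overlap of period `r` in the Thue–Morse sequence `t`.
-/
theorem thueStep_squareFree (r : ℕ) (hr : 0 < r) (i : ℕ) :
    ∃ j < r, thueStep (i + j) ≠ thueStep (i + r + j) := by
  by_contra! h
  have step : ∀ m n, thueStep m = thueStep n →
      ((thueMorse (m + 1)).toNat : ℤ) - (thueMorse m).toNat =
        (thueMorse (n + 1)).toNat - (thueMorse n).toNat := by
    intro m n
    unfold thueStep
    cases thueMorse m <;> cases thueMorse n <;> cases thueMorse (m + 1) <;>
      cases thueMorse (n + 1) <;> simp
  have key : ∀ j ≤ r, ((thueMorse (i + j)).toNat : ℤ) - (thueMorse i).toNat =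
      (thueMorse (i + r + j)).toNat - (thueMorse (i + r)).toNat := by
    intro j
    induction j with
    | zero => simp
    | succ j ih =>
      intro hj
      have h1 := ih (by omega)
      have h2 := step _ _ (h j (by omega))
      rw [← add_assoc, ← add_assoc]
      omega
  have h0 : thueMorse i = thueMorse (i + r) := by
    have := key r le_rfl
    revert this
    cases thueMorse i <;> cases thueMorse (i + r) <;> cases thueMorse (i + r + r) <;> simp
  obtain ⟨j, hj, hne⟩ := thueMorse_overlapFree r hr i
  have := key j hj
  rw [show i + r + j = i + j + r by ring, h0] at this
  apply hne
  revert this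
  cases thueMorse (i + j) <;> cases thueMorse (i + j + r) <;> (simp; try omega)

/-- A square-free sequence over four letters in which letters at distance two differ. -/
def fourLetter (n : ℕ) : Fin 4 :=
  if n % 3 = 2 then 3 else thueStep (2 * (n / 3) + n % 3)

theorem fourLetter_eq_three_iff (n : ℕ) : fourLetter n = 3 ↔ n % 3 = 2 := by
  unfold fourLetter
  split_ifs with h
  · simp [h]
  · simp [h, thueStep_ne_three]

theorem thueStep_ne_succ (n : ℕ) : thueStep n ≠ thueStep (n + 1) := by
  obtain ⟨j, hj, hne⟩ := thueStep_squareFree 1 one_pos n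
  obtain rfl : j = 0 := by omega
  simpa using hne

/-- At most one of the two positions carries the separator 3. If neither does, the letters are
consecutive in `thueStep`. -/
theorem fourLetter_ne_add_two (n : ℕ) : fourLetter n ≠ fourLetter (n + 2) := by
  intro h
  have h3 : n % 3 = 2 ↔ (n + 2) % 3 = 2 := by
    rw [← fourLetter_eq_three_iff, ← fourLetter_eq_three_iff, h]
  have hn : n % 3 = 1 := by omega
  unfold fourLetter at h
  rw [if_neg (by omega), if_neg (by omega), show 2 * ((n + 2) / 3) + (n + 2) % 3 =
    2 * (n / 3) + n % 3 + 1 by omega] at h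
  exact thueStep_ne_succ _ h

/-- The separators sit at every third position, so a square of period at least three has period 3q;
deleting them leaves a square of period 2q in `thueStep`. Periods one and two are excluded by hand.
-/
theorem fourLetter_squareFree (r : ℕ) (hr : 0 < r) (i : ℕ) :
    ∃ j < r, fourLetter (i + j) ≠ fourLetter (i + r + j) := by
  by_contra! h
  have h3 : ∀ j < r, (i + j) % 3 = 2 ↔ (i + r + j) % 3 = 2 := by
    intro j hj
    rw [← fourLetter_eq_three_iff, ← fourLetter_eq_three_iff, h j hj]
  have hr2 : r ≠ 2 := by
    rintro rfl
    exact fourLetter_ne_add_two i (h 0 (by omega))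
  have hr1 : r ≠ 1 := by
    rintro rfl
    have h1 := h3 0 (by omega)
    have h0 := h 0 (by omega)
    unfold fourLetter at h0
    simp only [add_zero] at h0 h1
    rw [if_neg (by omega), if_neg (by omega), show 2 * ((i + 1) / 3) + (i + 1) % 3 =
      2 * (i / 3) + i % 3 + 1 by omega] at h0
    exact thueStep_ne_succ _ h0
  obtain ⟨q, rfl⟩ : ∃ q, r = 3 * q := by
    have h1 := h3 0 (by omega)
    have h2 := h3 1 (by omega)
    have h4 := h3 2 (by omega)
    exact ⟨r / 3, by omega⟩
  obtain ⟨j, hj, hne⟩ := thueStep_squareFree (2 * q) (by omega) (2 * (i / 3) + i % 3)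
  -- Letter `a` of `thueStep` stands at position 3(a/2) + a%2 of `fourLetter`.
  obtain ⟨a, ha⟩ : ∃ a, a = 2 * (i / 3) + i % 3 + j := ⟨_, rfl⟩
  have hlt : 3 * (a / 2) + a % 2 - i < 3 * q := by omega
  have hge : i ≤ 3 * (a / 2) + a % 2 := by omega
  have := h _ hlt
  rw [show i + (3 * (a / 2) + a % 2 - i) = 3 * (a / 2) + a % 2 by omega,
    show i + 3 * q + (3 * (a / 2) + a % 2 - i) = 3 * (a / 2) + a % 2 + 3 * q by omega] at this
  unfold fourLetter at this
  rw [if_neg (by omega), if_neg (by omega),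
    show 2 * ((3 * (a / 2) + a % 2) / 3) + (3 * (a / 2) + a % 2) % 3 = a by omega,
    show 2 * ((3 * (a / 2) + a % 2 + 3 * q) / 3) + (3 * (a / 2) + a % 2 + 3 * q) % 3 =
      a + 2 * q by omega] at this
  apply hne
  rw [← ha, this]
  congr 1
  omega

theorem fourLetter_ne_succ (n : ℕ) : fourLetter n ≠ fourLetter (n + 1) := by
  obtain ⟨j, hj, hne⟩ := fourLetter_squareFree 1 one_pos n
  obtain rfl : j = 0 := by omega
  simpa using hne

/-! ## Nonrepetitive colourings of forests -/

namespace SimpleGraph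

variable {V : Type*} {T : SimpleGraph V}

/-- The distance to a fixed root of the component. -/
noncomputable def depth (T : SimpleGraph V) (v : V) : ℕ :=
  T.dist (T.connectedComponentMk v).out v

theorem reachable_componentRoot (v : V) : T.Reachable (T.connectedComponentMk v).out v :=
  ConnectedComponent.exact (Quot.out_eq _)

theorem componentRoot_eq_of_adj {u v : V} (h : T.Adj u v) :
    (T.connectedComponentMk u).out = (T.connectedComponentMk v).out := by
  rw [ConnectedComponent.sound h.reachable]

theorem IsAcyclic.depth_adj (hT : T.IsAcyclic) {u v : V} (h : T.Adj u v) :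
    T.depth u = T.depth v + 1 ∨ T.depth v = T.depth u + 1 := by
  unfold depth
  rw [← componentRoot_eq_of_adj h]
  exact hT.dist_eq_dist_add_one_of_adj_of_reachable _ h (reachable_componentRoot u)

/-- If `v` were not on the path from the root to `u`, then `u` would lie on a shortest path from the
root to `v`, and `v` would not be closer to the root. -/
theorem IsAcyclic.eq_penultimate_of_depth (hT : T.IsAcyclic) {u v : V} (h : T.Adj u v)
    (hd : T.depth u = T.depth v + 1) {p : T.Walk (T.connectedComponentMk u).out u}
    (hp : p.IsPath) : v = p.penultimate := by
  refine hT.eq_penultimate_of_adj_end hp h ?_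
  by_contra hv
  have hr := reachable_componentRoot (T := T) v
  unfold depth at hd
  rw [← componentRoot_eq_of_adj h] at hd hr
  obtain ⟨q, hq, hql⟩ := hr.exists_path_of_dist
  have hu : u ∈ q.support := by
    by_contra hu
    exact hv (hT.mem_support_of_ne_mem_support_of_adj_of_isPath hp hq h hu)
  classical
  have := SimpleGraph.dist_le (q.takeUntil u hu)
  have := q.length_takeUntil_le_length hu
  omega

/-- Uniqueness of the parent; it excludes interior local maxima of the depth along a path. -/
theorem IsAcyclic.eq_of_depth (hT : T.IsAcyclic) {u v w : V} (hv : T.Adj u v) (hw : T.Adj u w)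
    (hdv : T.depth u = T.depth v + 1) (hdw : T.depth u = T.depth w + 1) : v = w := by
  obtain ⟨p, hp, -⟩ := (reachable_componentRoot (T := T) u).exists_path_of_dist
  rw [hT.eq_penultimate_of_depth hv hdv hp, hT.eq_penultimate_of_depth hw hdw hp]

end SimpleGraph

/-- A height function along a path that has no interior local maximum goes down to a lowest
position and then up. -/
theorem exists_valley (g : ℕ → ℕ) (n : ℕ) (hn : 0 < n)
    (hstep : ∀ i, i + 1 < n → g i = g (i + 1) + 1 ∨ g (i + 1) = g i + 1)
    (hmax : ∀ i, i + 2 < n → g (i + 1) = g i + 1 → g (i + 2) = g (i + 1) + 1) :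
    ∃ m < n, ∀ i < n, (i ≤ m → g i = g m + (m - i)) ∧ (m ≤ i → g i = g m + (i - m)) := by
  induction n with
  | zero => omega
  | succ n ih =>
    rcases Nat.eq_zero_or_pos n with rfl | hpos
    · refine ⟨0, one_pos, fun i hi => ?_⟩
      obtain rfl : i = 0 := by omega
      simp
    obtain ⟨m, hm, h⟩ := ih hpos (fun i hi => hstep i (by omega)) (fun i hi => hmax i (by omega))
    have hlast := hstep (n - 1) (by omega)
    rw [show n - 1 + 1 = n by omega] at hlast
    rcases Nat.lt_or_ge m (n - 1) with hlt | hge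
    · have h1 := (h (n - 1) (by omega)).2 (by omega)
      have h2 := (h (n - 2) (by omega)).2 (by omega)
      have h3 := hmax (n - 2) (by omega)
      rw [show n - 2 + 1 = n - 1 by omega, show n - 2 + 2 = n by omega] at h3
      refine ⟨m, by omega, fun i hi => ?_⟩
      rcases Nat.lt_or_ge i n with hi' | hi'
      · exact h i hi'
      · obtain rfl : i = n := by omega
        omega
    · obtain rfl : m = n - 1 := by omega
      rcases hlast with hl | hl
      · refine ⟨n, by omega, fun i hi => ?_⟩
        rcases Nat.lt_or_ge i n with hi' | hi'
        · have := (h i hi').1 (by omega)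
          omega
        · obtain rfl : i = n := by omega
          omega
      · refine ⟨n - 1, by omega, fun i hi => ?_⟩
        rcases Nat.lt_or_ge i n with hi' | hi'
        · exact h i hi'
        · obtain rfl : i = n := by omega
          omega

/-- No square arises from `fourLetter` along a path whose turning point is in its first half. -/
theorem fourLetter_valley_no_square (g : ℕ → ℕ) (r : ℕ) (m : ℕ) (hm : m < r)
    (h : ∀ i < 2 * r, (i ≤ m → g i = g m + (m - i)) ∧ (m ≤ i → g i = g m + (i - m))) :
    ∃ j < r, fourLetter (g j) ≠ fourLetter (g (j + r)) := by
  by_contra! hc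
  have hr : 0 < r := by omega
  rcases Nat.eq_zero_or_pos m with rfl | hpos
  · obtain ⟨j, hj, hne⟩ := fourLetter_squareFree r hr (g 0)
    have h1 := (h j (by omega)).2 (by omega)
    have h2 := (h (j + r) (by omega)).2 (by omega)
    apply hne
    rw [show g 0 + j = g j by omega, show g 0 + r + j = g (j + r) by omega]
    exact hc j hj
  -- Positions m - 1 and m + 1 have the same depth. If both lie in the first half, their copies in
  -- the second half have equal letters at distance two.
  rcases Nat.lt_or_ge (m + 1) r with hlt | hge
  · have h1 := (h (m - 1) (by omega)).1 (by omega)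
    have h2 := (h (m + 1) (by omega)).2 (by omega)
    have h3 := (h (m - 1 + r) (by omega)).2 (by omega)
    have h4 := (h (m + 1 + r) (by omega)).2 (by omega)
    apply fourLetter_ne_add_two (g (m - 1 + r))
    rw [← hc _ (by omega), show g (m - 1 + r) + 2 = g (m + 1 + r) by omega, ← hc _ (by omega)]
    congr 1
    omega
  -- With the turn at the end of the first half, the square makes a block of consecutive letters a
  -- palindrome. Its centre gives equal letters at distance one or two.
  · obtain rfl : r = m + 1 := by omega
    have pal : ∀ j < m + 1, fourLetter (g m + (m - j)) = fourLetter (g m + (j + 1)) := by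
      intro j hj
      have h1 := (h j (by omega)).1 (by omega)
      have h2 := (h (j + (m + 1)) (by omega)).2 (by omega)
      rw [← h1, show g m + (j + 1) = g (j + (m + 1)) by omega]
      exact hc j hj
    rcases Nat.even_or_odd' m with ⟨q, rfl | rfl⟩
    · have := pal q (by omega)
      rw [show 2 * q - q = q by omega, ← add_assoc] at this
      exact fourLetter_ne_succ _ this
    · have := pal (q + 1) (by omega)
      rw [show 2 * q + 1 - (q + 1) = q by omega, show q + 1 + 1 = q + 2 by ring,
        ← add_assoc] at this
      exact fourLetter_ne_add_two _ this

/-- A forest has a colouring with four colours in which no path is repetitively coloured. -/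
theorem SimpleGraph.IsAcyclic.exists_nonrepetitive_colouring {V : Type*} {T : SimpleGraph V}
    (hT : T.IsAcyclic) : ∃ c : V → Fin 4, ∀ (x : ℕ → V) (r : ℕ), 0 < r →
      (∀ i, i + 1 < 2 * r → T.Adj (x i) (x (i + 1))) →
      (∀ i < 2 * r, ∀ j < 2 * r, x i = x j → i = j) →
      ∃ j < r, c (x j) ≠ c (x (j + r)) := by
  refine ⟨fun v => fourLetter (T.depth v), fun x r hr hadj hinj => ?_⟩
  have hmax : ∀ i, i + 2 < 2 * r → T.depth (x (i + 1)) = T.depth (x i) + 1 →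
      T.depth (x (i + 2)) = T.depth (x (i + 1)) + 1 := by
    intro i hi hd
    rcases hT.depth_adj (hadj (i + 1) (by omega)) with h | h
    · have := hinj i (by omega) (i + 2) (by omega)
        (hT.eq_of_depth (hadj i (by omega)).symm (hadj (i + 1) (by omega)) hd h)
      omega
    · exact h
  obtain ⟨m, hm, h⟩ := exists_valley (fun i => T.depth (x i)) (2 * r) (by omega)
    (fun i hi => hT.depth_adj (hadj i hi)) hmax
  rcases Nat.lt_or_ge m r with hlt | hge
  · exact fourLetter_valley_no_square (fun i => T.depth (x i)) r m hlt h
  · obtain ⟨j, hj, hne⟩ := fourLetter_valley_no_square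
      (fun i => T.depth (x (2 * r - 1 - i))) r (2 * r - 1 - m) (by omega) (fun i hi => by
        have := h (2 * r - 1 - i) (by omega)
        simp only [show 2 * r - 1 - (2 * r - 1 - m) = m by omega]
        constructor
        · intro hi'
          rw [this.2 (by omega)]
          omega
        · intro hi'
          rw [this.1 (by omega)]
          omega)
    refine ⟨r - 1 - j, by omega, ?_⟩
    rw [show 2 * r - 1 - j = r - 1 - j + r by omega, show 2 * r - 1 - (j + r) = r - 1 - j by omega]
      at hne
    exact hne.symm

/-! ## Mod-2 homology of planar embeddings -/

namespace EmbeddedGraph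

variable {V D : Type*}

section Basic

variable (G : EmbeddedGraph V D)

theorem faceNext_apply (d : D) : G.faceNext d = G.rotation (G.reverse d) := rfl

theorem faceNext_reverse (d : D) : G.faceNext (G.reverse d) = G.rotation d := by
  rw [faceNext_apply, G.reverse_reverse]

theorem tail_rotation (d : D) : G.tail (G.rotation d) = G.tail d :=
  (G.tail_eq_iff _ _).2 (Equiv.Perm.sameCycle_apply_left.2 (Equiv.Perm.SameCycle.refl _ _))

theorem tail_faceNext (d : D) : G.tail (G.faceNext d) = G.head d := by
  rw [faceNext_apply, tail_rotation, head]

theorem head_reverse (d : D) : G.head (G.reverse d) = G.tail d := by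
  rw [head, G.reverse_reverse]

theorem tail_reverse (d : D) : G.tail (G.reverse d) = G.head d := rfl

theorem reverse_eq_iff (d e : D) : G.reverse d = e ↔ d = G.reverse e := by
  constructor <;> rintro rfl <;> rw [G.reverse_reverse]

theorem reachable_tail_head (d : D) : G.toSimpleGraph.Reachable (G.tail d) (G.head d) := by
  by_cases h : G.tail d = G.head d
  · rw [h]
  · exact SimpleGraph.Adj.reachable ⟨h, d, rfl, rfl⟩

end Basic

/-- A function on permuted elements that is constant along each step is constant on cycles. -/
theorem _root_.Equiv.Perm.SameCycle.apply_eq {α β : Type*} [Finite α] {f : Equiv.Perm α}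
    {x y : α} (h : f.SameCycle x y) {g : α → β} (hg : ∀ z, f.SameCycle x z → g (f z) = g z) :
    g y = g x := by
  obtain ⟨n, -, rfl⟩ := h.exists_pow_eq'
  clear h
  induction n with
  | zero => rfl
  | succ n ih =>
    rw [pow_succ', Equiv.Perm.mul_apply, hg _ ⟨n, by rw [zpow_natCast]⟩, ih]

theorem _root_.funZModTwo_add_self {α : Type*} (x : α → ZMod 2) : x + x = 0 :=
  funext fun _ => CharTwo.add_self_eq_zero _

/-! ### Chains, boundaries and the dimension count over the field with two elements. -/

section Homology

variable (G : EmbeddedGraph V D)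

open Classical in
/-- The mod-2 chain of the edge of a dart. -/
noncomputable def edgeChain (d : D) : D → ZMod 2 :=
  Pi.single d 1 + Pi.single (G.reverse d) 1

theorem edgeChain_reverse (d e : D) : G.edgeChain d (G.reverse e) = G.edgeChain d e := by
  classical
  simp only [edgeChain, Pi.add_apply, Pi.single_apply, G.reverse_eq_iff e d,
    EmbeddedGraph.reverse_eq_iff G e (G.reverse d), G.reverse_reverse]
  exact add_comm _ _

/-- The quotient by the cycles of a permutation. -/
abbrev Cycles (f : Equiv.Perm D) : Type _ := Quotient (Equiv.Perm.SameCycle.setoid f)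

abbrev Cycles.mk (f : Equiv.Perm D) (d : D) : Cycles f :=
  Quotient.mk (Equiv.Perm.SameCycle.setoid f) d

theorem Cycles.mk_apply (f : Equiv.Perm D) (d : D) : Cycles.mk f (f d) = Cycles.mk f d :=
  Quotient.sound (Equiv.Perm.sameCycle_apply_left.2 (Equiv.Perm.SameCycle.refl f d))

/-- The mod-2 coboundary from functions on faces to 1-chains. -/
noncomputable def faceDiff : (Cycles G.faceNext → ZMod 2) →ₗ[ZMod 2] (D → ZMod 2) where
  toFun f d := f (.mk _ d) + f (.mk _ (G.reverse d))
  map_add' f g := by funext d; simp only [Pi.add_apply]; ring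
  map_smul' a f := by funext d; simp [mul_add]

/-- Functions on edges as functions on darts. -/
noncomputable def edgePull : (Cycles G.reverse → ZMod 2) →ₗ[ZMod 2] (D → ZMod 2) :=
  LinearMap.funLeft (ZMod 2) (ZMod 2) (Cycles.mk G.reverse)

theorem edgePull_injective : Function.Injective G.edgePull :=
  LinearMap.funLeft_injective_of_surjective _ _ _ Quotient.mk_surjective

variable [Fintype D]

theorem mem_range_edgePull {c : D → ZMod 2} (hc : ∀ d, c (G.reverse d) = c d) :
    ∃ e, G.edgePull e = c := by
  refine ⟨Quotient.lift c fun a b (h : G.reverse.SameCycle a b) => ?_, ?_⟩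
  · exact (h.apply_eq fun z _ => hc z).symm
  · funext d
    rfl

open Classical in
/-- The mod-2 boundary of a 1-chain. -/
noncomputable def boundary (c : D → ZMod 2) (v : V) : ZMod 2 :=
  ∑ d, if G.tail d = v then c d else 0

theorem boundary_add (c c' : D → ZMod 2) : G.boundary (c + c') = G.boundary c + G.boundary c' := by
  funext v
  simp only [boundary, Pi.add_apply, ← Finset.sum_add_distrib]
  refine Finset.sum_congr rfl fun d _ => ?_
  split_ifs <;> simp

theorem boundary_zero : G.boundary 0 = 0 := by
  funext v
  simp [boundary]

open Classical in
theorem boundary_edgeChain (d : D) :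
    G.boundary (G.edgeChain d) = Pi.single (G.tail d) 1 + Pi.single (G.head d) 1 := by
  funext v
  rw [edgeChain, boundary_add]
  have key : ∀ e : D, G.boundary (Pi.single e 1) v = if v = G.tail e then 1 else 0 := by
    intro e
    rw [boundary, Finset.sum_eq_single e]
    · simp [eq_comm]
    · intro b _ hb
      simp [hb]
    · simp
  simp only [Pi.add_apply, key, Pi.single_apply]
  rfl

/-- The boundary as a linear map on functions on edges. -/
noncomputable def edgeBoundary : (Cycles G.reverse → ZMod 2) →ₗ[ZMod 2] (V → ZMod 2) where
  toFun e := G.boundary (G.edgePull e)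
  map_add' e e' := by rw [map_add, boundary_add]
  map_smul' a e := by
    funext v
    simp only [map_smul, boundary, Pi.smul_apply, RingHom.id_apply, Finset.smul_sum]
    refine Finset.sum_congr rfl fun d _ => ?_
    split_ifs <;> simp

open Classical in
-- The reverse of `d` lies on the same face as the rotation of `d`, and rotation permutes the darts
-- at a vertex. So both halves of the sum agree and cancel mod 2.
theorem boundary_faceDiff (f : Cycles G.faceNext → ZMod 2) : G.boundary (G.faceDiff f) = 0 := by
  funext v
  have h : (∑ d, if G.tail d = v then f (.mk _ (G.reverse d)) else 0) =
      ∑ d, if G.tail d = v then f (.mk _ d) else 0 := by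
    rw [← Equiv.sum_comp G.rotation (fun d => if G.tail d = v then f (.mk _ d) else 0)]
    refine Finset.sum_congr rfl fun d _ => ?_
    simp only [tail_rotation]
    rw [← faceNext_reverse, Cycles.mk_apply]
  have : G.boundary (G.faceDiff f) v = (∑ d, if G.tail d = v then f (.mk _ d) else 0) +
      ∑ d, if G.tail d = v then f (.mk _ (G.reverse d)) else 0 := by
    rw [boundary, ← Finset.sum_add_distrib]
    refine Finset.sum_congr rfl fun d _ => ?_
    split_ifs
    · rfl
    · simp
  rw [this, h, CharTwo.add_self_eq_zero]
  rfl

/-- Equal values on both sides of every edge give equal values at successive corners of a vertex,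
and then along any walk. -/
theorem eq_of_faceDiff_eq_zero {f : Cycles G.faceNext → ZMod 2} (hf : G.faceDiff f = 0) {d e : D}
    (h : G.toSimpleGraph.Reachable (G.tail d) (G.tail e)) :
    f (.mk _ d) = f (.mk _ e) := by
  have hrev : ∀ d, f (.mk _ (G.reverse d)) = f (.mk _ d) := by
    intro d
    have := congrFun hf d
    exact (CharTwo.add_eq_zero.1 this).symm
  have hrot : ∀ d, f (.mk _ (G.rotation d)) = f (.mk _ d) := by
    intro d
    rw [← faceNext_reverse, Cycles.mk_apply, hrev]
  have htail : ∀ d e, G.tail d = G.tail e → f (.mk _ d) = f (.mk _ e) := by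
    intro d e hde
    exact (((G.tail_eq_iff d e).1 hde).apply_eq (g := fun d => f (.mk _ d)) fun z _ => hrot z).symm
  obtain ⟨p⟩ := h
  generalize hu : G.tail d = u at p
  generalize hv : G.tail e = v at p
  induction p generalizing d with
  | nil => exact htail d e (hu.trans hv.symm)
  | cons huw p ih =>
    obtain ⟨-, d', rfl, hw⟩ := huw
    rw [htail d d' hu, ← hrev d']
    exact ih hw hv

variable [Finite V]

open Classical in
-- Any two vertices of a component differ by a boundary, so boundaries and one root per component
-- span all functions on `V`.
theorem card_le_finrank_range_edgeBoundary :
    Nat.card V ≤ Module.finrank (ZMod 2) (LinearMap.range G.edgeBoundary) +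
      Nat.card G.toSimpleGraph.ConnectedComponent := by
  have := Fintype.ofFinite V
  have := Fintype.ofFinite G.toSimpleGraph.ConnectedComponent
  let R := LinearMap.range G.edgeBoundary
  let b : G.toSimpleGraph.ConnectedComponent → V → ZMod 2 := fun c => Pi.single c.out 1
  have hadj : ∀ u v, G.toSimpleGraph.Reachable u v →
      (Pi.single u 1 + Pi.single v 1 : V → ZMod 2) ∈ R := by
    rintro u v ⟨p⟩
    induction p with
    | nil =>
      rw [funZModTwo_add_self]
      exact R.zero_mem
    | @cons u w v huw p ih =>
      obtain ⟨-, d, rfl, rfl⟩ := huw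
      obtain ⟨e, he⟩ := G.mem_range_edgePull (G.edgeChain_reverse d)
      have h1 : (Pi.single (G.tail d) 1 + Pi.single (G.head d) 1 : V → ZMod 2) ∈ R :=
        ⟨e, by rw [← boundary_edgeChain, ← he]; rfl⟩
      have h2 := R.add_mem h1 ih
      have h3 : (Pi.single (G.head d) 1 + Pi.single (G.head d) 1 : V → ZMod 2) = 0 :=
        funZModTwo_add_self _
      rw [add_assoc, ← add_assoc (Pi.single (G.head d) 1 : V → ZMod 2), h3, zero_add] at h2
      exact h2
  have htop : R ⊔ Submodule.span (ZMod 2) (Set.range b) = ⊤ := by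
    rw [eq_top_iff, ← (Pi.basisFun (ZMod 2) V).span_eq, Submodule.span_le]
    rintro _ ⟨v, rfl⟩
    rw [Pi.basisFun_apply]
    have h1 := hadj v _ (SimpleGraph.reachable_componentRoot (T := G.toSimpleGraph) v).symm
    have h2 : b (G.toSimpleGraph.connectedComponentMk v) ∈ Submodule.span (ZMod 2) (Set.range b) :=
      Submodule.subset_span ⟨_, rfl⟩
    have h3 := add_mem (Submodule.mem_sup_left h1) (Submodule.mem_sup_right h2)
    rwa [add_assoc, funZModTwo_add_self, add_zero] at h3
  have h1 := Submodule.finrank_add_le_finrank_add_finrank R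
    (Submodule.span (ZMod 2) (Set.range b))
  rw [htop, finrank_top, Module.finrank_fintype_fun_eq_card] at h1
  have h2 := finrank_range_le_card (R := ZMod 2) b
  rw [Set.finrank] at h2
  rw [Nat.card_eq_fintype_card, Nat.card_eq_fintype_card]
  change _ ≤ Module.finrank (ZMod 2) R + _
  omega

/-- A function in the kernel is determined by one value for each component that has a dart. Each
isolated vertex is a further component. -/
theorem finrank_ker_faceDiff_add_le :
    Module.finrank (ZMod 2) (LinearMap.ker G.faceDiff) + Nat.card {v : V // ∀ d, G.tail d ≠ v} ≤
      Nat.card G.toSimpleGraph.ConnectedComponent := by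
  classical
  have := Fintype.ofFinite G.toSimpleGraph.ConnectedComponent
  let comp := G.toSimpleGraph.connectedComponentMk
  let E := {c : G.toSimpleGraph.ConnectedComponent // ∃ d, comp (G.tail d) = c}
  let rep : E → D := fun c => c.2.choose
  have hrep : ∀ c : E, comp (G.tail (rep c)) = c := fun c => c.2.choose_spec
  let ev : LinearMap.ker G.faceDiff →ₗ[ZMod 2] (E → ZMod 2) :=
    LinearMap.funLeft (ZMod 2) (ZMod 2) (fun c : E => Cycles.mk G.faceNext (rep c)) ∘ₗ
      Submodule.subtype _
  have hev : Function.Injective ev := by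
    rw [← LinearMap.ker_eq_bot, LinearMap.ker_eq_bot']
    rintro ⟨f, hf⟩ h0
    apply Subtype.ext
    funext q
    obtain ⟨d, rfl⟩ := Quotient.exists_rep q
    have h1 : f (.mk _ (rep ⟨comp (G.tail d), d, rfl⟩)) = 0 := congrFun h0 _
    have h2 := G.eq_of_faceDiff_eq_zero (LinearMap.mem_ker.1 hf)
      (SimpleGraph.ConnectedComponent.exact (hrep ⟨comp (G.tail d), d, rfl⟩))
    exact h2.symm.trans h1
  have h1 := LinearMap.finrank_le_finrank_of_injective hev
  rw [Module.finrank_fintype_fun_eq_card, ← Nat.card_eq_fintype_card] at h1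
  have h2 : Nat.card (E ⊕ {v : V // ∀ d, G.tail d ≠ v}) ≤
      Nat.card G.toSimpleGraph.ConnectedComponent := by
    refine Nat.card_le_card_of_injective
      (Sum.elim (fun c => c.1) (fun v => comp v.1)) ?_
    have iso : ∀ v : {v : V // ∀ d, G.tail d ≠ v}, ∀ u, comp v = comp u → v = u := by
      rintro ⟨v, hv⟩ u h
      obtain ⟨p⟩ := SimpleGraph.ConnectedComponent.exact h
      cases p with
      | nil => rfl
      | cons hadj p =>
        obtain ⟨-, d, hd, -⟩ := hadj
        exact absurd hd (hv d)
    rintro (⟨a, d, ha⟩ | a) (⟨b, e, hb⟩ | b) hab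
    · simp only [Sum.elim_inl] at hab
      subst hab
      rfl
    · exact absurd (iso b _ (hab.symm.trans ha.symm)).symm (b.2 d)
    · exact absurd (iso a _ (hab.trans hb.symm)).symm (a.2 e)
    · exact congrArg Sum.inr (Subtype.ext (iso a _ hab))
  rw [Nat.card_sum] at h2
  omega

variable {G}

/-- In a planar embedding every 1-cycle mod 2 is the boundary of a set of faces. -/
theorem IsPlanar.exists_face_function (hG : G.IsPlanar) {c : D → ZMod 2}
    (hrev : ∀ d, c (G.reverse d) = c d) (hc : G.boundary c = 0) :
    ∃ f : D → ZMod 2, (∀ d, f (G.faceNext d) = f d) ∧ ∀ d, f (G.reverse d) = f d + c d := by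
  classical
  have := Fintype.ofFinite (Cycles G.faceNext)
  have := Fintype.ofFinite (Cycles G.reverse)
  have hle : LinearMap.range G.faceDiff ≤ (LinearMap.ker G.edgeBoundary).map G.edgePull := by
    rintro _ ⟨f, rfl⟩
    obtain ⟨e, he⟩ := G.mem_range_edgePull (c := G.faceDiff f) (fun d => by
      change _ + f (.mk _ (G.reverse (G.reverse d))) = _ + _
      rw [G.reverse_reverse, add_comm])
    refine ⟨e, ?_, he⟩
    change G.boundary (G.edgePull e) = 0
    rw [he, boundary_faceDiff]
  have heq : LinearMap.range G.faceDiff = (LinearMap.ker G.edgeBoundary).map G.edgePull := by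
    -- With C components and I isolated vertices, the cycle space has dimension at most E - V + C
    -- and the range of `faceDiff` at least F + I - C. Euler's formula says that these bounds are
    -- equal.
    apply Submodule.eq_of_le_of_finrank_le hle
    rw [← (Submodule.equivMapOfInjective _ G.edgePull_injective _).finrank_eq]
    have h1 := G.faceDiff.finrank_range_add_finrank_ker
    have h2 := G.edgeBoundary.finrank_range_add_finrank_ker
    have h3 := G.card_le_finrank_range_edgeBoundary
    have h4 := G.finrank_ker_faceDiff_add_le
    have h5 := hG
    rw [Module.finrank_fintype_fun_eq_card, ← Nat.card_eq_fintype_card] at h1 h2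
    change Nat.card V + (Nat.card (Cycles G.faceNext) + _) = Nat.card (Cycles G.reverse) + _ at h5
    omega
  obtain ⟨e, he⟩ := G.mem_range_edgePull hrev
  have hmem : c ∈ LinearMap.range G.faceDiff := by
    rw [heq, ← he]
    refine ⟨e, ?_, rfl⟩
    change G.boundary (G.edgePull e) = 0
    rw [he, hc]
  obtain ⟨f, rfl⟩ := hmem
  refine ⟨fun d => f (.mk _ d), fun d => congrArg f (Cycles.mk_apply _ d), fun d => ?_⟩
  change _ = f (.mk _ d) + (f (.mk _ d) + f (.mk _ (G.reverse d)))
  rw [← add_assoc, CharTwo.add_self_eq_zero, zero_add]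

end Homology

end EmbeddedGraph

/-! ## Facial segments in outerplane graphs -/

namespace EmbeddedGraph

variable {V D : Type*}

open Classical in
/-- The indicator of a dart, with values mod 2. -/
noncomputable def dartInd (d y : D) : ZMod 2 := if d = y then 1 else 0

theorem dartInd_self (d : D) : dartInd d d = 1 := if_pos rfl

theorem dartInd_of_ne {d y : D} (h : d ≠ y) : dartInd d y = 0 := if_neg h

theorem dartInd_apply (f : Equiv.Perm D) (d y : D) : dartInd (f d) (f y) = dartInd d y := by
  by_cases h : d = y
  · rw [h, dartInd_self, dartInd_self]
  · rw [dartInd_of_ne h, dartInd_of_ne (f.injective.ne h)]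

variable (G : EmbeddedGraph V D)

theorem edgeChain_apply (d y : D) : G.edgeChain d y = dartInd d y + dartInd d (G.reverse y) := by
  classical
  rw [edgeChain, Pi.add_apply, Pi.single_apply, Pi.single_apply, dartInd, dartInd]
  have h : y = G.reverse d ↔ d = G.reverse y := by
    rw [← G.reverse_eq_iff, eq_comm]
  rw [if_congr h rfl rfl, if_congr eq_comm rfl rfl]

/-- The number mod 2 of visits to a dart by the facial segment of length `n` from `d`. -/
noncomputable def segCount (d : D) (n : ℕ) (y : D) : ZMod 2 :=
  ∑ i ∈ Finset.range n, dartInd ((G.faceNext ^ i) d) y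

/-- The 1-chain mod 2 of the facial segment of length `n` from `d`. -/
noncomputable def segChain (d : D) (n : ℕ) : D → ZMod 2 :=
  ∑ i ∈ Finset.range n, G.edgeChain ((G.faceNext ^ i) d)

theorem segChain_apply (d : D) (n : ℕ) (y : D) :
    G.segChain d n y = G.segCount d n y + G.segCount d n (G.reverse y) := by
  simp only [segChain, segCount, Finset.sum_apply, edgeChain_apply, Finset.sum_add_distrib]

theorem segChain_reverse (d : D) (n : ℕ) (y : D) :
    G.segChain d n (G.reverse y) = G.segChain d n y := by
  rw [segChain_apply, segChain_apply, G.reverse_reverse, add_comm]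

theorem segCount_eq_zero {d : D} {n : ℕ} {y : D} (h : ∀ i < n, (G.faceNext ^ i) d ≠ y) :
    G.segCount d n y = 0 :=
  Finset.sum_eq_zero fun i hi => dartInd_of_ne (h i (Finset.mem_range.1 hi))

theorem segCount_eq_one {d : D} {n i : ℕ} (hi : i < n)
    (h : ∀ j < n, (G.faceNext ^ j) d = (G.faceNext ^ i) d → j = i) :
    G.segCount d n ((G.faceNext ^ i) d) = 1 := by
  rw [segCount, Finset.sum_eq_single i, dartInd_self]
  · intro j hj hne
    exact dartInd_of_ne fun h' => hne (h j (Finset.mem_range.1 hj) h')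
  · intro h'
    exact absurd (Finset.mem_range.2 hi) h'

/-- The dart `rotation y` follows `reverse y` on its facial walk, so the segment visits both equally
often, up to a correction at its two ends. -/
theorem segCount_rotation (d : D) (n : ℕ) (y : D) :
    G.segCount d n (G.rotation y) = G.segCount d n (G.reverse y) + dartInd d (G.rotation y) +
      dartInd ((G.faceNext ^ n) d) (G.rotation y) := by
  have h2 : (2 : ZMod 2) = 0 := rfl
  induction n with
  | zero =>
    simp only [segCount, Finset.range_zero, Finset.sum_empty, pow_zero, Equiv.Perm.one_apply]
    linear_combination -dartInd d (G.rotation y) * h2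
  | succ n ih =>
    simp only [segCount, Finset.sum_range_succ] at ih ⊢
    have : dartInd ((G.faceNext ^ (n + 1)) d) (G.rotation y) =
        dartInd ((G.faceNext ^ n) d) (G.reverse y) := by
      rw [pow_succ', Equiv.Perm.mul_apply, ← faceNext_reverse, dartInd_apply]
    rw [ih, this]
    linear_combination (dartInd ((G.faceNext ^ n) d) (G.rotation y) -
      dartInd ((G.faceNext ^ n) d) (G.reverse y)) * h2

theorem tail_faceNext_pow_succ (d : D) (n : ℕ) :
    G.tail ((G.faceNext ^ (n + 1)) d) = G.head ((G.faceNext ^ n) d) := by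
  rw [pow_succ', Equiv.Perm.mul_apply, tail_faceNext]

theorem sameCycle_pow (f : Equiv.Perm D) (d : D) (n : ℕ) : f.SameCycle d ((f ^ n) d) :=
  ⟨n, by rw [zpow_natCast]⟩

open Classical in
theorem boundary_segChain [Fintype D] (d : D) (n : ℕ) :
    G.boundary (G.segChain d n) =
      Pi.single (G.tail d) 1 + Pi.single (G.tail ((G.faceNext ^ n) d)) 1 := by
  induction n with
  | zero =>
    rw [segChain, Finset.range_zero, Finset.sum_empty, boundary_zero, pow_zero]
    exact (funZModTwo_add_self _).symm
  | succ n ih =>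
    have : G.segChain d (n + 1) = G.segChain d n + G.edgeChain ((G.faceNext ^ n) d) :=
      Finset.sum_range_succ _ _
    rw [this, boundary_add, ih, boundary_edgeChain, tail_faceNext_pow_succ, add_assoc,
      ← add_assoc (Pi.single (G.tail ((G.faceNext ^ n) d)) 1), funZModTwo_add_self, zero_add]

/-- `u` and `v` are joined by a walk inside `S`. -/
def ReachIn (S : Set V) (u v : V) : Prop :=
  ∃ (hu : u ∈ S) (hv : v ∈ S), (G.toSimpleGraph.induce S).Reachable ⟨u, hu⟩ ⟨v, hv⟩

variable {G}

theorem ReachIn.symm {S : Set V} {u v : V} (h : G.ReachIn S u v) : G.ReachIn S v u := by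
  obtain ⟨hu, hv, h⟩ := h
  exact ⟨hv, hu, h.symm⟩

theorem ReachIn.of_connected {S : Set V} (h : (G.toSimpleGraph.induce S).Connected) {u v : V}
    (hu : u ∈ S) (hv : v ∈ S) : G.ReachIn S u v :=
  ⟨hu, hv, h.preconnected _ _⟩

theorem reachIn_segment {S : Set V} (y : D) (n : ℕ)
    (h : ∀ i ≤ n, G.tail ((G.faceNext ^ i) y) ∈ S) :
    G.ReachIn S (G.tail y) (G.tail ((G.faceNext ^ n) y)) := by
  induction n with
  | zero => exact ⟨h 0 le_rfl, h 0 le_rfl, .refl _⟩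
  | succ n ih =>
    obtain ⟨hu, hv, hr⟩ := ih fun i hi => h i (by omega)
    refine ⟨hu, h (n + 1) le_rfl, hr.trans ?_⟩
    by_cases heq : G.tail ((G.faceNext ^ n) y) = G.tail ((G.faceNext ^ (n + 1)) y)
    · simp only [heq]
      exact .refl _
    · refine SimpleGraph.Adj.reachable ?_
      exact ⟨heq, _, rfl, (G.tail_faceNext_pow_succ y n).symm⟩

open Classical in
theorem ReachIn.exists_chain [Fintype D] {S : Set V} {u v : V} (h : G.ReachIn S u v) :
    ∃ p : D → ZMod 2, (∀ d, p (G.reverse d) = p d) ∧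
      G.boundary p = Pi.single u 1 + Pi.single v 1 ∧ ∀ d, G.tail d ∉ S → p d = 0 := by
  obtain ⟨hu, hv, ⟨w⟩⟩ := h
  generalize hu' : (⟨u, hu⟩ : S) = u' at w
  generalize hv' : (⟨v, hv⟩ : S) = v' at w
  induction w generalizing u with
  | nil =>
    obtain rfl : u = v := congrArg Subtype.val (hu'.trans hv'.symm)
    exact ⟨0, fun _ => rfl, by rw [boundary_zero, funZModTwo_add_self], fun _ _ => rfl⟩
  | @cons a b c hab w ih =>
    obtain ⟨p, hp1, hp2, hp3⟩ := ih b.2 rfl hv'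
    subst hu'
    obtain ⟨-, d, rfl, hd⟩ := hab
    change G.head d = b at hd
    refine ⟨G.edgeChain d + p, fun e => ?_, ?_, fun e he => ?_⟩
    · rw [Pi.add_apply, Pi.add_apply, edgeChain_reverse, hp1]
    · rw [boundary_add, boundary_edgeChain, hp2, hd, add_assoc, ← add_assoc (Pi.single (b : V) 1),
        funZModTwo_add_self, zero_add]
    · rw [Pi.add_apply, hp3 e he, edgeChain_apply, dartInd_of_ne, dartInd_of_ne]
      · simp
      · rintro rfl
        rw [head_reverse] at hd
        exact he (hd ▸ b.2)
      · rintro rfl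
        exact he hu

theorem sameCycle_reachable [Finite D] {d e : D} (h : G.faceNext.SameCycle d e) :
    G.toSimpleGraph.Reachable (G.tail d) (G.tail e) := by
  obtain ⟨n, -, rfl⟩ := h.exists_pow_eq'
  obtain ⟨_, _, hr⟩ := reachIn_segment (S := Set.univ) d n fun _ _ => trivial
  exact hr.map (SimpleGraph.Embedding.induce _).toHom

theorem pow_mem_outer_iff (d : D) (n : ℕ) : (G.faceNext ^ n) d ∈ G.outer ↔ d ∈ G.outer := by
  induction n with
  | zero => rfl
  | succ n ih =>
    rw [pow_succ', Equiv.Perm.mul_apply, faceNext_apply, G.outer_iff, ih]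

theorem mem_outer_iff_of_sameCycle [Finite D] {d e : D} (h : G.faceNext.SameCycle d e) :
    e ∈ G.outer ↔ d ∈ G.outer := by
  obtain ⟨n, -, rfl⟩ := h.exists_pow_eq'
  exact pow_mem_outer_iff d n

theorem segCount_outer {d : D} (hd : d ∉ G.outer) (n : ℕ) {e : D} (he : e ∈ G.outer) :
    G.segCount d n e = 0 :=
  G.segCount_eq_zero fun i _ h => hd ((pow_mem_outer_iff d i).1 (h ▸ he))

theorem eq_of_rotation_invariant [Finite D] {β : Type*} {g : D → β} {d e : D}
    (h : G.tail d = G.tail e) (hg : ∀ y, G.tail y = G.tail d → g (G.rotation y) = g y) :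
    g e = g d :=
  ((G.tail_eq_iff d e).1 h).apply_eq fun z hz => hg z ((G.tail_eq_iff d z).2 hz).symm

theorem IsOuterplane.face_function_outer [Finite D] (hG : G.IsOuterplane) {f : D → ZMod 2}
    (hf : ∀ d, f (G.faceNext d) = f d) {d e : D} (hd : d ∈ G.outer) (he : e ∈ G.outer)
    (h : G.toSimpleGraph.Reachable (G.tail d) (G.tail e)) : f e = f d :=
  (hG.outer_unique d hd e he h).apply_eq fun z _ => hf z

open Classical in
/-- Close up the segment of length `n` from `d` on the boundary of an inner face by a chain `p`.
Visits of the face to vertices off `p` and different from the ends are all inside the segment or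
all outside it. -/
theorem IsOuterplane.segCount_eq [Finite V] [Fintype D] (hG : G.IsOuterplane) {d : D}
    (hd : d ∉ G.outer) (n : ℕ) {p : D → ZMod 2} (hrev : ∀ y, p (G.reverse y) = p y)
    (hp : G.boundary p = Pi.single (G.tail d) 1 + Pi.single (G.tail ((G.faceNext ^ n) d)) 1)
    {y y' : D} (hy : G.faceNext.SameCycle d y) (hy' : G.faceNext.SameCycle d y')
    (h1 : G.tail d ≠ G.tail y) (h2 : G.tail ((G.faceNext ^ n) d) ≠ G.tail y)
    (h1' : G.tail d ≠ G.tail y') (h2' : G.tail ((G.faceNext ^ n) d) ≠ G.tail y')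
    (h3 : ∀ z, G.tail z = G.tail y → p z = 0) (h3' : ∀ z, G.tail z = G.tail y' → p z = 0) :
    G.segCount d n y = G.segCount d n y' := by
  obtain ⟨f, hf, hfr⟩ := hG.planar.exists_face_function (c := G.segChain d n + p)
    (fun z => by rw [Pi.add_apply, Pi.add_apply, segChain_reverse, hrev])
    (by rw [boundary_add, boundary_segChain, hp, funZModTwo_add_self])
  -- Off `p` and the ends, `f` plus the visit count is constant around a vertex. At an outer dart
  -- the count is zero, because the segment runs along an inner face.
  have main : ∀ y, G.tail d ≠ G.tail y → G.tail ((G.faceNext ^ n) d) ≠ G.tail y →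
      (∀ z, G.tail z = G.tail y → p z = 0) →
      ∃ e ∈ G.outer, G.tail e = G.tail y ∧ f e = f y + G.segCount d n y := by
    intro y h1 h2 h3
    obtain ⟨e, he, hey⟩ := hG.incident_outer y
    refine ⟨e, he, hey, ?_⟩
    have hc := eq_of_rotation_invariant (g := fun z => f z + G.segCount d n z) hey.symm
      fun z hz => by
        have hfz := hf (G.reverse z)
        rw [faceNext_reverse, hfr, Pi.add_apply, segChain_apply, h3 z hz] at hfz
        rw [hfz, segCount_rotation, dartInd_of_ne (d := d), dartInd_of_ne]
        · have h2 : (2 : ZMod 2) = 0 := rfl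
          linear_combination G.segCount d n (G.reverse z) * h2
        · rintro h
          exact h2 (by rw [h, tail_rotation, hz])
        · rintro h
          exact h1 (by rw [h, tail_rotation, hz])
    simpa only [segCount_outer hd n he, add_zero] using hc
  obtain ⟨e, he, hey, hfe⟩ := main y h1 h2 h3
  obtain ⟨e', he', hey', hfe'⟩ := main y' h1' h2' h3'
  have hee : f e' = f e := by
    refine hG.face_function_outer hf he he' ?_
    rw [hey, hey']
    exact (sameCycle_reachable hy).symm.trans (sameCycle_reachable hy')
  have hfy : f y = f d := hy.apply_eq fun z _ => hf z
  have hfy' : f y' = f d := hy'.apply_eq fun z _ => hf z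
  rw [hfe, hfe', hfy, hfy'] at hee
  exact (add_left_cancel hee).symm

/-- The set of vertices on the face of a dart. -/
def faceVertices (G : EmbeddedGraph V D) (d : D) : Set V :=
  {v | ∃ y, G.faceNext.SameCycle d y ∧ G.tail y = v}

/-- If removing `t` separated two vertices of the face, a facial segment between consecutive visits
to `t` would be a closed curve through one of them and not the other. That contradicts
`segCount_eq`, as both are on the outer face. -/
theorem IsOuterplane.isTwoConnectedOn_faceVertices [Finite V] [Finite D] (hG : G.IsOuterplane)
    {d : D} (hd : d ∉ G.outer) (h : 2 < (G.faceVertices d).ncard) :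
    G.IsTwoConnectedOn (G.faceVertices d) := by
  classical
  have := Fintype.ofFinite D
  refine ⟨h, fun T hT hTc => ?_⟩
  rw [SimpleGraph.connected_iff]
  constructor
  swap
  · by_contra hemp
    have hsub : G.faceVertices d ⊆ T := by
      intro v hv
      by_contra hvT
      exact hemp ⟨⟨v, hv, hvT⟩⟩
    have := Set.ncard_le_ncard hsub (Set.toFinite T)
    omega
  suffices H : ∀ y₁ y₂, G.faceNext.SameCycle d y₁ → G.faceNext.SameCycle d y₂ → G.tail y₁ ∉ T →
      G.tail y₂ ∉ T → G.ReachIn (G.faceVertices d \ T) (G.tail y₁) (G.tail y₂) by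
    rintro ⟨u, ⟨y₁, hy₁, rfl⟩, hu⟩ ⟨v, ⟨y₂, hy₂, rfl⟩, hv⟩
    exact (H y₁ y₂ hy₁ hy₂ hu hv).2.2
  intro y₁ y₂ hy₁ hy₂ ht₁ ht₂
  have hon : ∀ z, G.faceNext.SameCycle d z → ∀ i, G.tail ((G.faceNext ^ i) z) ∈ G.faceVertices d :=
    fun z hz i => ⟨_, hz.trans (sameCycle_pow _ _ _), rfl⟩
  rcases (show T.ncard = 0 ∨ T.ncard = 1 by omega) with h0 | h1
  · obtain rfl : T = ∅ := (Set.ncard_eq_zero (Set.toFinite T)).1 h0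
    obtain ⟨n, -, rfl⟩ := (hy₁.symm.trans hy₂).exists_pow_eq'
    exact reachIn_segment _ _ fun i _ => ⟨hon _ hy₁ i, id⟩
  obtain ⟨t, rfl⟩ := Set.ncard_eq_one.1 h1
  obtain ⟨z₀, hz₀, hz₀t⟩ := hT rfl
  -- The dart `z` will be the last visit to `t` before `y₁`, and `n` below the first return to `t`
  -- after `z`.
  have hex : ∃ k z, G.tail z = t ∧ (G.faceNext ^ k) z = y₁ := by
    obtain ⟨k, -, hk⟩ := (hz₀.symm.trans hy₁).exists_pow_eq'
    exact ⟨k, z₀, hz₀t, hk⟩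
  obtain ⟨z, hzt, hzk⟩ := Nat.find_spec hex
  generalize hk : Nat.find hex = k at hzk
  have hkmin : ∀ m < k, ∀ z, G.tail z = t → (G.faceNext ^ m) z ≠ y₁ :=
    fun m hm z hz hzm => Nat.find_min hex (hk ▸ hm) ⟨z, hz, hzm⟩
  have hz : G.faceNext.SameCycle d z := hy₁.trans (hzk ▸ (sameCycle_pow _ z k)).symm
  have hex' : ∃ n, 0 < n ∧ G.tail ((G.faceNext ^ n) z) = t :=
    ⟨orderOf G.faceNext, orderOf_pos _, by rw [pow_orderOf_eq_one]; exact hzt⟩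
  obtain ⟨hn0, hnt⟩ := Nat.find_spec hex'
  generalize hn : Nat.find hex' = n at hn0 hnt
  have hnmin : ∀ m < n, 0 < m → G.tail ((G.faceNext ^ m) z) ≠ t :=
    fun m hm hm0 hmt => Nat.find_min hex' (hn ▸ hm) ⟨hm0, hmt⟩
  have hkn : k < n := by
    by_contra hle
    refine hkmin (k - n) (by omega) _ hnt ?_
    rw [← Equiv.Perm.mul_apply, ← pow_add, Nat.sub_add_cancel (by omega), hzk]
  have hinj : ∀ i j, i < j → j < n → (G.faceNext ^ i) z ≠ (G.faceNext ^ j) z := by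
    intro i j hij hjn heq
    rw [show j = i + (j - i) by omega, pow_add, Equiv.Perm.mul_apply] at heq
    exact hnmin (j - i) (by omega) (by omega) (((G.faceNext ^ i).injective heq) ▸ hzt)
  by_contra hnr
  have hcount := hG.segCount_eq (fun ho => hd ((mem_outer_iff_of_sameCycle hz).1 ho)) n (p := 0)
    (d := z) (fun _ => rfl)
    (by rw [boundary_zero, hnt, hzt, funZModTwo_add_self]) (hz.symm.trans hy₁) (hz.symm.trans hy₂)
    (by rw [hzt]; exact fun h => ht₁ h.symm) (by rw [hnt]; exact fun h => ht₁ h.symm)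
    (by rw [hzt]; exact fun h => ht₂ h.symm) (by rw [hnt]; exact fun h => ht₂ h.symm)
    (fun _ _ => rfl) (fun _ _ => rfl)
  have hk0 : 0 < k := by
    rcases Nat.eq_zero_or_pos k with rfl | h
    · exact absurd (hzt ▸ congrArg G.tail hzk.symm) ht₁
    · exact h
  have between : ∀ i j, 0 < i → i ≤ j → j < n →
      G.ReachIn (G.faceVertices d \ {t}) (G.tail ((G.faceNext ^ i) z))
        (G.tail ((G.faceNext ^ j) z)) := by
    intro i j hi hij hjn
    have := reachIn_segment (S := G.faceVertices d \ {t}) ((G.faceNext ^ i) z) (j - i)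
      fun l hl => by
        rw [← Equiv.Perm.mul_apply, ← pow_add]
        exact ⟨hon z hz _, hnmin _ (by omega) (by omega)⟩
    rwa [← Equiv.Perm.mul_apply, ← pow_add, Nat.sub_add_cancel hij] at this
  rw [G.segCount_eq_zero (y := y₂), ← hzk, G.segCount_eq_one hkn] at hcount
  · exact one_ne_zero hcount
  · intro j hj heq
    rcases lt_trichotomy j k with hlt | rfl | hlt
    · exact absurd heq (hinj _ _ hlt hkn)
    · rfl
    · exact absurd heq.symm (hinj _ _ hlt hj)
  · rintro j hj rfl
    have hj0 : 0 < j := by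
      rcases Nat.eq_zero_or_pos j with rfl | h
      · exact absurd hzt ht₂
      · exact h
    apply hnr
    rw [← hzk]
    rcases le_total j k with hle | hle
    · exact (between j k hj0 hle hkn).symm
    · exact between k j hk0 hle hj

theorem IsTwoConnectedOn.union [Finite V] {S S' : Set V} (hS : G.IsTwoConnectedOn S)
    (hS' : G.IsTwoConnectedOn S') {a b : V} (hab : a ≠ b) (ha : a ∈ S ∩ S') (hb : b ∈ S ∩ S') :
    G.IsTwoConnectedOn (S ∪ S') := by
  refine ⟨hS.1.trans_le (Set.ncard_le_ncard Set.subset_union_left (Set.toFinite _)),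
    fun T _ hTc => ?_⟩
  have part : ∀ R, G.IsTwoConnectedOn R → (G.toSimpleGraph.induce (R \ T)).Connected := by
    intro R hR
    have := hR.2 (R ∩ T) Set.inter_subset_left
      ((Set.ncard_le_ncard Set.inter_subset_right (Set.toFinite _)).trans_lt hTc)
    rwa [Set.sdiff_self_inter] at this
  rw [Set.union_sdiff_distrib]
  refine SimpleGraph.induce_union_connected (part S hS).preconnected (part S' hS').preconnected ?_
  -- At most one vertex is removed, so `a` or `b` survives and links the two connected remainders.
  by_cases haT : a ∈ T
  · refine ⟨b, ⟨hb.1, ?_⟩, hb.2, ?_⟩ <;>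
    · intro hbT
      have h2 := Set.ncard_le_ncard (Set.insert_subset haT (Set.singleton_subset_iff.2 hbT))
        (Set.toFinite T)
      rw [Set.ncard_pair hab] at h2
      omega
  · exact ⟨a, ⟨ha.1, haT⟩, ha.2, haT⟩

theorem IsTwoConnectedOn.exists_component [Finite V] {S : Set V} (hS : G.IsTwoConnectedOn S) :
    ∃ H, S ⊆ H ∧ G.IsTwoConnectedComponent H :=
  (Set.toFinite {S | G.IsTwoConnectedOn S}).exists_le_maximal hS

/-- A 2-connected set lies in a 2-connected component `H`, and the tree `H - B` is connected. -/
theorem IsBlockingSet.reachIn [Finite V] {B S : Set V} (hB : G.IsBlockingSet B)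
    (hS : G.IsTwoConnectedOn S) {u v : V} (hu : u ∈ S \ B) (hv : v ∈ S \ B) :
    G.ReachIn Bᶜ u v := by
  obtain ⟨H, hSH, hH⟩ := hS.exists_component
  have := ReachIn.of_connected (hB.1 H hH).1.connected (Set.sdiff_subset_sdiff_left hSH hu)
    (Set.sdiff_subset_sdiff_left hSH hv)
  obtain ⟨_, _, hr⟩ := this
  exact ⟨hu.2, hv.2, hr.map (SimpleGraph.induceHomOfLE _ (fun x hx => hx.2)).toHom⟩

open Classical in
/-- If both sides of an edge are inner faces, then these faces are not joined off the edge. -/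
theorem IsOuterplane.false_of_inner_edge [Finite V] [Fintype D] (hG : G.IsOuterplane) {d d₁ : D}
    (hd : d ∉ G.outer) (hd' : G.reverse d ∉ G.outer) {m n : ℕ} (hm : (G.faceNext ^ m) d₁ = d)
    {p : D → ZMod 2} (hrev : ∀ y, p (G.reverse y) = p y)
    (hp : G.boundary p =
      Pi.single (G.tail d₁) 1 + Pi.single (G.tail ((G.faceNext ^ n) (G.rotation d))) 1)
    (ht : ∀ z, G.tail z = G.tail d → p z = 0) (hh : ∀ z, G.tail z = G.head d → p z = 0)
    (h1 : G.tail d₁ ≠ G.tail d) (h1' : G.tail d₁ ≠ G.head d)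
    (h2 : G.tail ((G.faceNext ^ n) (G.rotation d)) ≠ G.tail d)
    (h2' : G.tail ((G.faceNext ^ n) (G.rotation d)) ≠ G.head d) : False := by
  have two : (2 : ZMod 2) = 0 := rfl
  have hd₁ : d₁ ∉ G.outer := fun h => hd (hm ▸ (pow_mem_outer_iff d₁ m).2 h)
  have hσ : G.rotation d ∉ G.outer := by
    rw [← faceNext_reverse, faceNext_apply, G.outer_iff]
    exact hd'
  obtain ⟨f, hf, hfr⟩ := hG.planar.exists_face_function
    (c := G.segChain d₁ m + G.segChain (G.rotation d) n + p)
    (fun z => by simp only [Pi.add_apply, segChain_reverse, hrev])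
    (by
      rw [boundary_add, boundary_add, boundary_segChain, boundary_segChain, hp, hm, tail_rotation,
        add_assoc (Pi.single (G.tail d₁) 1 : V → ZMod 2), ← add_assoc (Pi.single (G.tail d) 1),
        funZModTwo_add_self, zero_add, funZModTwo_add_self])
  -- The first segment ends at `d` and the second starts at `rotation d`; the indicator of `d`
  -- absorbs both corrections. Geometrically, the curve passes through the tail of `d` with `d`
  -- alone on one side.
  have main : ∀ y, G.tail d₁ ≠ G.tail y → G.tail ((G.faceNext ^ n) (G.rotation d)) ≠ G.tail y →
      (∀ z, G.tail z = G.tail y → p z = 0) → ∃ e ∈ G.outer, G.tail e = G.tail y ∧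
        f e = f y + G.segCount d₁ m y + G.segCount (G.rotation d) n y + dartInd d y := by
    intro y h1 h2 h3
    obtain ⟨e, he, hey⟩ := hG.incident_outer y
    refine ⟨e, he, hey, ?_⟩
    have hc := eq_of_rotation_invariant
      (g := fun z => f z + G.segCount d₁ m z + G.segCount (G.rotation d) n z + dartInd d z)
      hey.symm fun z hz => by
        have hfz := hf (G.reverse z)
        rw [faceNext_reverse, hfr, Pi.add_apply, Pi.add_apply, segChain_apply, segChain_apply,
          h3 z hz] at hfz
        rw [hfz, segCount_rotation, segCount_rotation, dartInd_apply, hm, dartInd_of_ne (d := d₁),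
          dartInd_of_ne (d := (G.faceNext ^ n) (G.rotation d))]
        · linear_combination (G.segCount d₁ m (G.reverse z) +
            G.segCount (G.rotation d) n (G.reverse z) + dartInd d (G.rotation z)) * two
        · rintro h
          exact h2 (by rw [h, tail_rotation, hz])
        · rintro h
          exact h1 (by rw [h, tail_rotation, hz])
    simpa only [segCount_outer hd₁ m he, segCount_outer hσ n he,
      dartInd_of_ne (fun h => hd (h ▸ he) : d ≠ e), add_zero] using hc
  obtain ⟨e, he, hey, hfe⟩ := main d h1 h2 ht
  obtain ⟨e', he', hey', hfe'⟩ := main (G.reverse d) h1' h2' hh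
  have hee : f e' = f e := by
    refine hG.face_function_outer hf he he' ?_
    rw [hey, hey']
    exact G.reachable_tail_head d
  -- The visit counts cancel against the jump of `f` across `d`. The outer values at the two ends of
  -- the edge then differ by the indicator of `d`, which is 1.
  rw [hfe, hfe', hfr, Pi.add_apply, Pi.add_apply, segChain_apply, segChain_apply, ht d rfl,
    dartInd_self, dartInd_of_ne (G.reverse_ne d).symm] at hee
  refine one_ne_zero (α := ZMod 2) ?_
  linear_combination -hee + (G.segCount d₁ m (G.reverse d) +
    G.segCount (G.rotation d) n (G.reverse d)) * two

/-- An edge between two vertices of a blocking set is incident to the outer face. -/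
theorem IsOuterplane.reverse_mem_outer [Finite V] [Finite D] (hG : G.IsOuterplane) {B : Set V}
    (hB : G.IsBlockingSet B) {d : D} (hd : d ∉ G.outer) (ht : G.tail d ∈ B) (hh : G.head d ∈ B) :
    G.reverse d ∈ G.outer := by
  classical
  have := Fintype.ofFinite D
  by_contra hd'
  obtain ⟨e, hde, he⟩ := hB.2 d hd
  obtain ⟨e', hde', he'⟩ := hB.2 _ hd'
  -- A loop is itself a closed curve separating the faces on its two sides. Each of them has a
  -- vertex off `B`, hence off the loop, where `f` takes its outer value.
  by_cases hloop : G.tail d = G.head d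
  · obtain ⟨f, hf, hfr⟩ := hG.planar.exists_face_function (c := G.edgeChain d)
      (G.edgeChain_reverse d) (by rw [boundary_edgeChain, hloop, funZModTwo_add_self])
    have main : ∀ y, G.tail y ∉ B → ∃ e ∈ G.outer, G.tail e = G.tail y ∧ f e = f y := by
      intro y hy
      obtain ⟨e, he, hey⟩ := hG.incident_outer y
      refine ⟨e, he, hey, eq_of_rotation_invariant hey.symm fun z hz => ?_⟩
      rw [← faceNext_reverse, hf, hfr, edgeChain_apply, dartInd_of_ne, dartInd_of_ne, add_zero,
        add_zero]
      · rintro rfl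
        rw [head_reverse] at hh
        exact hy (hz ▸ hh)
      · rintro rfl
        exact hy (hz ▸ ht)
    obtain ⟨o, ho, hot, hof⟩ := main e he
    obtain ⟨o', ho', hot', hof'⟩ := main e' he'
    have hoo : f o' = f o := by
      refine hG.face_function_outer hf ho ho' ?_
      rw [hot, hot']
      exact ((sameCycle_reachable hde).symm.trans (G.reachable_tail_head d)).trans
        (sameCycle_reachable hde')
    have h1 : f e = f d := hde.apply_eq fun z _ => hf z
    have h2 : f e' = f (G.reverse d) := hde'.apply_eq fun z _ => hf z
    rw [hof, hof', h1, h2, hfr, edgeChain_apply, dartInd_self,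
      dartInd_of_ne (G.reverse_ne d).symm, add_zero] at hoo
    exact one_ne_zero (left_eq_add.1 hoo.symm)
  · have hne : ∀ {v}, v ∉ B → v ≠ G.tail d ∧ v ≠ G.head d :=
      fun hv => ⟨fun h => hv (h ▸ ht), fun h => hv (h ▸ hh)⟩
    have htF : G.tail d ∈ G.faceVertices d := ⟨d, .refl _ _, rfl⟩
    have hhF : G.head d ∈ G.faceVertices d :=
      ⟨G.faceNext d, Equiv.Perm.sameCycle_apply_right.2 (.refl _ _), G.tail_faceNext d⟩
    have htF' : G.tail d ∈ G.faceVertices (G.reverse d) :=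
      ⟨G.faceNext (G.reverse d), Equiv.Perm.sameCycle_apply_right.2 (.refl _ _), by
        rw [tail_faceNext, head_reverse]⟩
    have hhF' : G.head d ∈ G.faceVertices (G.reverse d) := ⟨_, .refl _ _, rfl⟩
    have hS := hG.isTwoConnectedOn_faceVertices hd ((Set.two_lt_ncard_iff (Set.toFinite _)).2
      ⟨_, _, _, htF, hhF, ⟨e, hde, rfl⟩, hloop, (hne he).1.symm, (hne he).2.symm⟩)
    have hS' := hG.isTwoConnectedOn_faceVertices hd' ((Set.two_lt_ncard_iff (Set.toFinite _)).2
      ⟨_, _, _, htF', hhF', ⟨e', hde', rfl⟩, hloop, (hne he').1.symm, (hne he').2.symm⟩)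
    -- The two face boundaries share both ends of the edge, so their union is 2-connected and the
    -- chosen vertices off `B` are joined off `B`.
    have hU := hS.union hS' hloop ⟨htF, htF'⟩ ⟨hhF, hhF'⟩
    obtain ⟨p, hp1, hp2, hp3⟩ := (hB.reachIn hU ⟨Or.inl ⟨e, hde, rfl⟩, he⟩
      ⟨Or.inr ⟨e', hde', rfl⟩, he'⟩).exists_chain
    obtain ⟨m, -, hm⟩ := hde.symm.exists_pow_eq'
    obtain ⟨n, -, hn⟩ := (Equiv.Perm.sameCycle_apply_left.2 hde').exists_pow_eq'
    rw [faceNext_reverse] at hn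
    subst hn
    exact hG.false_of_inner_edge hd hd' hm hp1 hp2
      (fun z hz => hp3 z fun h => h (hz ▸ ht)) (fun z hz => hp3 z fun h => h (hz ▸ hh))
      (hne he).1 (hne he).2 (hne he').1 (hne he').2

end EmbeddedGraph

/-! ## Vertices off a blocking set induce a forest -/

namespace SimpleGraph.Walk.IsCycle

variable {V : Type*} {T : SimpleGraph V} {v : V} {c : T.Walk v v}

theorem two_lt_ncard_support [Finite V] (hc : c.IsCycle) :
    2 < {x | x ∈ c.support}.ncard := by
  classical
  have h1 : (↑c.support.tail.toFinset : Set V) ⊆ {x | x ∈ c.support} := by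
    intro x hx
    exact List.mem_of_mem_tail (List.mem_toFinset.1 (Finset.mem_coe.1 hx))
  have h2 := Set.ncard_le_ncard h1 (Set.toFinite _)
  rw [Set.ncard_coe_finset, List.toFinset_card_of_nodup hc.support_nodup, List.length_tail,
    length_support] at h2
  have := hc.three_le_length
  omega

/-- Started at `t`, the cycle becomes a path once its first and last vertex are dropped. -/
theorem connected_induce_support_diff_singleton (hc : c.IsCycle) {t : V} (ht : t ∈ c.support) :
    (T.induce ({x | x ∈ c.support} \ {t})).Connected := by
  classical
  have hr := hc.rotate ht
  have hp := hr.isPath_tail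
  have hlen := hr.three_le_length
  have hnil : ¬ (c.rotate t ht).tail.Nil := by
    rw [not_nil_iff_lt_length, length_tail]
    omega
  have hsupp := support_dropLast_concat hnil
  have heq : {x | x ∈ c.support} \ {t} = {x | x ∈ (c.rotate t ht).tail.dropLast.support} := by
    ext x
    have h1 : x ∈ c.support ↔ x = t ∨ x ∈ (c.rotate t ht).tail.support := by
      rw [← mem_support_rotate_iff c t ht, support_tail_of_not_nil _ hr.not_nil, mem_support_iff]
    have hnd := hp.support_nodup
    rw [← hsupp, List.nodup_append] at hnd
    have h2 : x ∈ (c.rotate t ht).tail.support ↔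
        x ∈ (c.rotate t ht).tail.dropLast.support ∨ x = t := by
      rw [← hsupp]
      simp
    have h3 : x ∈ (c.rotate t ht).tail.dropLast.support → x ≠ t :=
      fun h => hnd.2.2 x h t (List.mem_singleton_self t)
    simp only [Set.mem_sdiff, Set.mem_ofPred_eq, Set.mem_singleton_iff, h1, h2]
    tauto
  rw [heq]
  exact connected_induce_support _

end SimpleGraph.Walk.IsCycle

namespace EmbeddedGraph

variable {V D : Type*} (G : EmbeddedGraph V D) (B : Set V)

/-- The edges of the underlying simple graph that avoid `B`. -/
def avoiding : SimpleGraph V where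
  Adj u v := G.toSimpleGraph.Adj u v ∧ u ∉ B ∧ v ∉ B
  symm := ⟨fun _ _ h => ⟨h.1.symm, h.2.2, h.2.1⟩⟩
  loopless := ⟨fun _ h => h.1.ne rfl⟩

variable {G B}

theorem avoiding_le : G.avoiding B ≤ G.toSimpleGraph := fun _ _ h => h.1

theorem isTwoConnectedOn_support [Finite V] {v : V} {c : G.toSimpleGraph.Walk v v}
    (hc : c.IsCycle) : G.IsTwoConnectedOn {x | x ∈ c.support} := by
  refine ⟨hc.two_lt_ncard_support, fun T hT hTc => ?_⟩
  rcases (show T.ncard = 0 ∨ T.ncard = 1 by omega) with h0 | h1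
  · obtain rfl : T = ∅ := (Set.ncard_eq_zero (Set.toFinite T)).1 h0
    rw [Set.sdiff_empty]
    exact c.connected_induce_support
  · obtain ⟨t, rfl⟩ := Set.ncard_eq_one.1 h1
    exact hc.connected_induce_support_diff_singleton (hT rfl)

/-- A cycle off `B` would be 2-connected, so it would lie in the tree `H - B` for some 2-connected
component `H`. -/
theorem IsBlockingSet.isAcyclic_avoiding [Finite V] (hB : G.IsBlockingSet B) :
    (G.avoiding B).IsAcyclic := by
  intro v c hc
  have hc' := hc.mapLe avoiding_le
  obtain ⟨H, hSH, hH⟩ := (isTwoConnectedOn_support hc').exists_component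
  have hsub : ∀ x ∈ (c.mapLe avoiding_le).support, x ∈ H \ B := by
    intro x hx
    refine ⟨hSH hx, ?_⟩
    rw [SimpleGraph.Walk.support_mapLe_eq_support] at hx
    obtain ⟨e, he, hxe⟩ :=
      (SimpleGraph.Walk.mem_support_iff_exists_mem_edges_of_not_nil hc.not_nil).1 hx
    have := c.edges_subset_edgeSet he
    induction e with
    | _ a b =>
      rcases Sym2.mem_iff.1 hxe with rfl | rfl
      · exact this.2.1
      · exact this.2.2
  refine (hB.1 H hH).1.isAcyclic ((c.mapLe avoiding_le).induce _ hsub) ?_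
  apply SimpleGraph.Walk.IsCycle.of_map (f := (SimpleGraph.Embedding.induce (H \ B)).toHom)
  rw [SimpleGraph.Walk.map_induce]
  exact hc'

end EmbeddedGraph

/-! ## Facial paths of the blocking graph -/

theorem firstReturn_eq {α : Type*} [Finite α] (f : Equiv.Perm α) (p : α → Prop)
    {x y : {x // p x}} (k : ℕ) (hy : (y : α) = (f ^ (k + 1)) x)
    (hk : ∀ j < k, ¬ p ((f ^ (j + 1)) x)) : firstReturn f p x = y := by
  obtain ⟨m, hm, hm'⟩ := firstReturnFun_spec f p x
  apply Subtype.ext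
  change (firstReturnFun f p x : α) = y
  rcases lt_trichotomy m k with h | rfl | h
  · exact absurd (hm ▸ (firstReturnFun f p x).2) (hk m h)
  · rw [hm, hy]
  · exact absurd (hy ▸ y.2) (hm' k h)

open Classical in
-- The first hit is recorded by its index `k`, so that in the induction it can be recognised as the
-- first return of the element placed in front.
theorem filter_iterate_firstReturn {α : Type*} [Finite α] (f : Equiv.Perm α) (p : α → Prop)
    (a : α) (n : ℕ) :
    (List.iterate f a n).filter (fun x => decide (p x)) = [] ∨
      ∃ (x : {x // p x}) (m k : ℕ), (x : α) = (f ^ k) a ∧ (∀ j < k, ¬ p ((f ^ j) a)) ∧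
        (List.iterate f a n).filter (fun x => decide (p x)) =
          (List.iterate (firstReturn f p) x m).map Subtype.val := by
  induction n generalizing a with
  | zero => exact Or.inl rfl
  | succ n ih =>
    rw [List.iterate]
    by_cases ha : p a
    · right
      rw [List.filter_cons_of_pos (by simpa using ha)]
      rcases ih (f a) with h | ⟨x, m, k, hx, hk, h⟩
      · exact ⟨⟨a, ha⟩, 1, 0, rfl, by simp, by rw [h]; rfl⟩
      · refine ⟨⟨a, ha⟩, m + 1, 0, rfl, by simp, ?_⟩
        have : firstReturn f p ⟨a, ha⟩ = x := by
          refine firstReturn_eq f p k ?_ fun j hj => ?_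
          · rw [hx, pow_succ, Equiv.Perm.mul_apply]
          · rw [pow_succ, Equiv.Perm.mul_apply]
            exact hk j hj
        rw [h, List.iterate, this]
        rfl
    · rw [List.filter_cons_of_neg (by simpa using ha)]
      rcases ih (f a) with h | ⟨x, m, k, hx, hk, h⟩
      · exact Or.inl h
      · refine Or.inr ⟨x, m, k + 1, ?_, fun j hj => ?_, h⟩
        · rw [hx, pow_succ, Equiv.Perm.mul_apply]
        · rcases j with _ | j
          · exact ha
          · rw [pow_succ, Equiv.Perm.mul_apply]
            exact hk j (by omega)

namespace EmbeddedGraph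

variable {V D : Type*} [Finite D] {G : EmbeddedGraph V D} {B : Set V}

theorem iterate_faceNext_blockingGraph_true (x : {d // G.Corner B d}) (m : ℕ) :
    List.iterate (G.blockingGraph B).faceNext (x, true) m =
      (List.iterate (G.nextCorner B) x m).map fun y => (y, true) := by
  induction m generalizing x with
  | zero => rfl
  | succ m ih =>
    rw [List.iterate, List.iterate, List.map_cons, ← ih]
    rfl

open Classical in
/-- The visits to `B` along a segment of the outer face form a facial segment of the blocking
graph. -/
theorem exists_blocking_segment_outer {d : D} (hd : d ∈ G.outer) (n : ℕ) :
    ((List.iterate G.faceNext d n).map G.tail).filter (fun v => decide (v ∈ B)) = [] ∨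
      ∃ e m, ((List.iterate (G.blockingGraph B).faceNext e m).map (G.blockingGraph B).tail).map
        Subtype.val =
          ((List.iterate G.faceNext d n).map G.tail).filter (fun v => decide (v ∈ B)) := by
  have hfil : ((List.iterate G.faceNext d n).map G.tail).filter (fun v => decide (v ∈ B)) =
      ((List.iterate G.faceNext d n).filter fun y => decide (G.Corner B y)).map G.tail := by
    rw [List.filter_map]
    congr 1
    refine List.filter_congr fun y hy => ?_
    obtain ⟨i, -, rfl⟩ := List.mem_iterate.1 hy
    have : (G.faceNext)^[i] d ∈ G.outer := by
      rw [Equiv.Perm.iterate_eq_pow, pow_mem_outer_iff]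
      exact hd
    simp [Corner, this]
  rw [hfil]
  rcases filter_iterate_firstReturn G.faceNext (G.Corner B) d n with h | ⟨x, m, k, -, -, h⟩
  · left
    rw [h]
    rfl
  · right
    refine ⟨(x, true), m, ?_⟩
    rw [h, iterate_faceNext_blockingGraph_true]
    simp only [List.map_map]
    rfl

/-- A segment of an inner face inside `B` is a facial segment of the blocking graph. -/
theorem exists_blocking_segment_inner {n : ℕ} {d : D} (hd : d ∉ G.outer)
    (hB : ∀ i ≤ n + 1, G.tail ((G.faceNext ^ i) d) ∈ B)
    (ho : ∀ i ≤ n, G.reverse ((G.faceNext ^ i) d) ∈ G.outer) :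
    ∃ x : {d // G.Corner B d}, (x : D) = G.reverse d ∧
      ((List.iterate (G.blockingGraph B).faceNext (x, false) (n + 2)).map
        (G.blockingGraph B).tail).map Subtype.val =
          (List.iterate G.faceNext d (n + 2)).map G.tail := by
  have hx : G.Corner B (G.reverse d) := ⟨ho 0 (by omega), by
    rw [tail_reverse, ← tail_faceNext]
    exact hB 1 (by omega)⟩
  -- On the outer walk `reverse y` is followed by `rotation y`, which already starts in `B`, so no
  -- vertex is skipped.
  have hnext : ∀ y, (hy : G.Corner B (G.reverse y)) → G.tail y ∈ B →
      (G.nextCorner B ⟨_, hy⟩ : D) = G.rotation y := by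
    intro y hy hyB
    have hc : G.Corner B (G.rotation y) := by
      refine ⟨?_, by rwa [tail_rotation]⟩
      rw [← faceNext_reverse, faceNext_apply, G.outer_iff]
      exact hy.1
    refine congrArg Subtype.val (firstReturn_eq G.faceNext (G.Corner B) (y := ⟨_, hc⟩) 0 ?_
      (by simp))
    rw [zero_add, pow_one]
    exact (G.faceNext_reverse y).symm
  have htail : ((G.blockingGraph B).tail (⟨_, hx⟩, false) : V) = G.tail d := by
    change G.tail (G.nextCorner B ⟨_, hx⟩) = _
    rw [hnext d hx (hB 0 (by omega)), tail_rotation]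
  refine ⟨⟨_, hx⟩, rfl, ?_⟩
  induction n generalizing d with
  | zero =>
    simp only [List.iterate, List.map_cons, List.map_nil, htail]
    congr 2
    change ((G.blockingGraph B).tail
      ((G.blockingGraph B).rotation ((G.blockingGraph B).reverse (⟨_, hx⟩, false))) : V) = _
    rw [tail_rotation]
    exact (G.tail_faceNext d).symm
  | succ n ih =>
    have hd' : G.faceNext d ∉ G.outer := by
      rw [faceNext_apply, G.outer_iff]
      exact hd
    have hB' : ∀ i ≤ n + 1, G.tail ((G.faceNext ^ i) (G.faceNext d)) ∈ B := fun i hi => by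
      rw [← Equiv.Perm.mul_apply, ← pow_succ]
      exact hB (i + 1) (by omega)
    have ho' : ∀ i ≤ n, G.reverse ((G.faceNext ^ i) (G.faceNext d)) ∈ G.outer := fun i hi => by
      rw [← Equiv.Perm.mul_apply (G.faceNext ^ i), ← pow_succ]
      exact ho (i + 1) (by omega)
    have hx' : G.Corner B (G.reverse (G.faceNext d)) := ⟨ho' 0 (by omega), by
      rw [tail_reverse, ← tail_faceNext]
      exact hB' 1 (by omega)⟩
    have htail' : ((G.blockingGraph B).tail (⟨_, hx'⟩, false) : V) = G.tail (G.faceNext d) := by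
      change G.tail (G.nextCorner B ⟨_, hx'⟩) = _
      rw [hnext _ hx' (hB' 0 (by omega)), tail_rotation]
    -- Turning from `reverse d`, the first dart is `faceNext d`, which is inner and no corner. The
    -- second is the outer dart that follows `reverse (faceNext d)` on the outer walk.
    have hstep : (G.blockingGraph B).faceNext (⟨_, hx⟩, false) = (⟨_, hx'⟩, false) := by
      change ((G.nextCorner B).symm (G.turnCorner B ⟨_, hx⟩), false) = _
      congr 1
      rw [Equiv.symm_apply_eq]
      refine firstReturn_eq G.rotation (G.Corner B) 1 ?_ fun j hj hc => ?_
      · exact hnext _ hx' (hB' 0 (by omega))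
      · obtain rfl : j = 0 := by omega
        exact hd' hc.1
    change ((G.blockingGraph B).tail (⟨_, hx⟩, false) : V) ::
      (((List.iterate (G.blockingGraph B).faceNext
        ((G.blockingGraph B).faceNext (⟨_, hx⟩, false)) (n + 2)).map
          (G.blockingGraph B).tail).map Subtype.val) =
      G.tail d :: (List.iterate G.faceNext (G.faceNext d) (n + 2)).map G.tail
    rw [hstep, ih hd' hB' ho' hx' htail', htail]

end EmbeddedGraph

/-! ## Colouring the outerplane graph -/

theorem Nonrepetitive.not_square {α : Type*} {w : List α} (h : Nonrepetitive (w ++ w)) :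
    w = [] := by
  by_contra hw
  exact h w hw (List.infix_refl _)

namespace EmbeddedGraph

variable {V D : Type*} {G : EmbeddedGraph V D} {B : Set V}

open Classical in
/-- Colour `B` by `c₀` and the other vertices by `t`, with disjoint sets of colours. -/
noncomputable def joinColouring {k : ℕ} (c₀ : B → Fin k) (t : V → Fin 4) (v : V) : Fin (k + 4) :=
  if h : v ∈ B then Fin.castAdd 4 (c₀ ⟨v, h⟩) else Fin.natAdd k (t v)

section JoinColouring

variable {k : ℕ} (c₀ : B → Fin k) (t : V → Fin 4)

theorem joinColouring_coe (b : B) : joinColouring c₀ t b = Fin.castAdd 4 (c₀ b) :=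
  dif_pos b.2

theorem joinColouring_of_notMem {v : V} (h : v ∉ B) : joinColouring c₀ t v = Fin.natAdd k (t v) :=
  dif_neg h

theorem joinColouring_lt_iff (v : V) : (joinColouring c₀ t v : ℕ) < k ↔ v ∈ B := by
  by_cases h : v ∈ B
  · simp [joinColouring, h]
  · simp [joinColouring, h]

theorem mem_iff_of_joinColouring_eq {u v : V} (h : joinColouring c₀ t u = joinColouring c₀ t v) :
    u ∈ B ↔ v ∈ B := by
  rw [← joinColouring_lt_iff c₀ t u, h, joinColouring_lt_iff]

open Classical in
/-- A square of colours restricts to a square on `B`. -/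
theorem filter_eq_nil_of_square [Finite D]
    (hc₀ : (G.blockingGraph B).IsFacialNonrepetitive c₀) {l : List V} (hl : l.Nodup)
    {w : List (Fin (k + 4))} (hw : l.map (joinColouring c₀ t) = w ++ w)
    {e : {d // G.Corner B d} × Bool} {m : ℕ}
    (he : ((List.iterate (G.blockingGraph B).faceNext e m).map (G.blockingGraph B).tail).map
      Subtype.val = l.filter (fun v => decide (v ∈ B))) :
    l.filter (fun v => decide (v ∈ B)) = [] := by
  generalize hlB : (List.iterate (G.blockingGraph B).faceNext e m).map (G.blockingGraph B).tail =
    lB at he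
  have hnd : lB.Nodup := List.Nodup.of_map Subtype.val (he ▸ hl.filter _)
  have hnr := hc₀ lB ⟨hnd, e, m, hlB.symm⟩
  have h1 : (lB.map c₀).map (Fin.castAdd 4) =
      (w ++ w).filter fun a : Fin (k + 4) => decide ((a : ℕ) < k) := by
    rw [← hw, List.filter_map]
    have : (fun a : Fin (k + 4) => decide ((a : ℕ) < k)) ∘ joinColouring c₀ t =
        fun v => decide (v ∈ B) := by
      funext v
      simp only [Function.comp_apply, joinColouring_lt_iff]
    rw [this, ← he, List.map_map, List.map_map]
    refine List.map_congr_left fun b _ => ?_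
    exact (joinColouring_coe c₀ t b).symm
  -- Colours below `k` mark exactly the vertices of `B`, so filtering both copies of `w` leaves a
  -- square.
  rw [List.filter_append, List.map_eq_append_iff] at h1
  obtain ⟨a, b, hab, ha, hb⟩ := h1
  obtain rfl : a = b := (Fin.castAdd_injective k 4).list_map (ha.trans hb.symm)
  rw [hab] at hnr
  obtain rfl := hnr.not_square
  rw [← he, List.map_eq_nil_iff.1 hab]
  rfl

end JoinColouring

/-- On an inner face a repetitive facial path does not meet both `B` and its complement. -/
theorem IsOuterplane.false_of_mixed_square [Finite V] [Finite D] (hG : G.IsOuterplane)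
    (hB : G.IsBlockingSet B) {d : D} (hd : d ∉ G.outer) {r : ℕ}
    (hinj : ∀ a < 2 * r, ∀ b < 2 * r,
      G.tail ((G.faceNext ^ a) d) = G.tail ((G.faceNext ^ b) d) → a = b)
    (hmem : ∀ j < r, (G.tail ((G.faceNext ^ j) d) ∈ B ↔ G.tail ((G.faceNext ^ (j + r)) d) ∈ B))
    {i j : ℕ} (hi : i < r) (hj : j < r) (hiB : G.tail ((G.faceNext ^ i) d) ∉ B)
    (hjB : G.tail ((G.faceNext ^ j) d) ∈ B) : False := by
  classical
  have := Fintype.ofFinite D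
  have hirB := fun h => hiB ((hmem i hi).2 h)
  have hjrB := (hmem j hj).1 hjB
  have hon : ∀ a, G.tail ((G.faceNext ^ a) d) ∈ G.faceVertices d :=
    fun a => ⟨_, sameCycle_pow _ _ _, rfl⟩
  have h2 := hG.isTwoConnectedOn_faceVertices hd ((Set.two_lt_ncard_iff (Set.toFinite _)).2
    ⟨_, _, _, hon i, hon (i + r), hon j,
      fun h => by have := hinj i (by omega) (i + r) (by omega) h; omega,
      fun h => hiB (h ▸ hjB), fun h => hirB (h ▸ hjB)⟩)
  obtain ⟨p, hp1, hp2, hp3⟩ := (hB.reachIn h2 ⟨hon i, hiB⟩ ⟨hon (i + r), hirB⟩).exists_chain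
  have hcyc : ∀ a b, G.faceNext.SameCycle ((G.faceNext ^ a) d) ((G.faceNext ^ b) d) :=
    fun a b => (sameCycle_pow _ _ _).symm.trans (sameCycle_pow _ _ _)
  have hadd : ∀ l, (G.faceNext ^ l) ((G.faceNext ^ i) d) = (G.faceNext ^ (i + l)) d := by
    intro l
    rw [← Equiv.Perm.mul_apply, ← pow_add, add_comm]
  have hne : ∀ {u v}, u ∉ B → v ∈ B → u ≠ v := fun hu hv h => hu (h ▸ hv)
  have hcount := hG.segCount_eq (d := (G.faceNext ^ i) d)
    (fun h => hd ((pow_mem_outer_iff d i).1 h)) r hp1 (by rw [hadd]; exact hp2) (hcyc i j)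
    (hcyc i (j + r)) (hne hiB hjB) (by rw [hadd]; exact hne hirB hjB) (hne hiB hjrB)
    (by rw [hadd]; exact hne hirB hjrB) (fun z hz => hp3 z fun h => h (hz ▸ hjB))
    (fun z hz => hp3 z fun h => h (hz ▸ hjrB))
  have one : ∀ a, a < 2 * r → i ≤ a → a < i + r →
      G.segCount ((G.faceNext ^ i) d) r ((G.faceNext ^ a) d) = 1 := by
    intro a ha hia har
    obtain ⟨l, rfl⟩ := Nat.exists_eq_add_of_le hia
    rw [← hadd]
    refine G.segCount_eq_one (by omega) fun m hm h => ?_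
    rw [hadd, hadd] at h
    have := hinj _ (by omega) _ ha (congrArg G.tail h)
    omega
  have zero : ∀ a, a < 2 * r → ¬ (i ≤ a ∧ a < i + r) →
      G.segCount ((G.faceNext ^ i) d) r ((G.faceNext ^ a) d) = 0 := by
    intro a ha hia
    refine G.segCount_eq_zero fun m hm h => ?_
    rw [hadd] at h
    have := hinj _ (by omega) _ ha (congrArg G.tail h)
    omega
  -- Exactly one of j and j + r lies between i and i + r, so the counts that should agree are 1 and
  -- 0.
  rcases le_or_gt i j with hij | hij
  · rw [one j (by omega) hij (by omega), zero (j + r) (by omega) (by omega)] at hcount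
    exact one_ne_zero hcount
  · rw [zero j (by omega) (by omega), one (j + r) (by omega) (by omega) (by omega)] at hcount
    exact zero_ne_one hcount

/-- Equal colours force equal membership in `B`. Paths off `B` are settled by the forest colouring,
all others by the blocking graph. -/
theorem IsOuterplane.exists_joinColouring_ne [Finite V] [Finite D]
    (hG : G.IsOuterplane) (hB : G.IsBlockingSet B) {k : ℕ} {c₀ : B → Fin k}
    (hc₀ : (G.blockingGraph B).IsFacialNonrepetitive c₀) {t : V → Fin 4}
    (ht : ∀ (x : ℕ → V) (r : ℕ), 0 < r →
      (∀ i, i + 1 < 2 * r → (G.avoiding B).Adj (x i) (x (i + 1))) →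
      (∀ i < 2 * r, ∀ j < 2 * r, x i = x j → i = j) → ∃ j < r, t (x j) ≠ t (x (j + r)))
    (d : D) {r : ℕ} (hr : 0 < r)
    (hinj : ∀ a < 2 * r, ∀ b < 2 * r,
      G.tail ((G.faceNext ^ a) d) = G.tail ((G.faceNext ^ b) d) → a = b) :
    ∃ j < r, joinColouring c₀ t (G.tail ((G.faceNext ^ j) d)) ≠
      joinColouring c₀ t (G.tail ((G.faceNext ^ (j + r)) d)) := by
  classical
  by_contra! hcol
  have hmem : ∀ j < r, (G.tail ((G.faceNext ^ j) d) ∈ B ↔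
      G.tail ((G.faceNext ^ (j + r)) d) ∈ B) :=
    fun j hj => mem_iff_of_joinColouring_eq c₀ t (hcol j hj)
  have hmem2 : ∀ a < 2 * r, ∃ j < r,
      (G.tail ((G.faceNext ^ a) d) ∈ B ↔ G.tail ((G.faceNext ^ j) d) ∈ B) := by
    intro a ha
    rcases Nat.lt_or_ge a r with h | h
    · exact ⟨a, h, Iff.rfl⟩
    · refine ⟨a - r, by omega, ?_⟩
      rw [hmem (a - r) (by omega), Nat.sub_add_cancel h]
  obtain ⟨j₀, hj₀, hj₀B⟩ : ∃ j < r, G.tail ((G.faceNext ^ j) d) ∈ B := by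
    by_contra! hno
    have hno2 : ∀ a < 2 * r, G.tail ((G.faceNext ^ a) d) ∉ B := by
      intro a ha h
      obtain ⟨j, hj, hja⟩ := hmem2 a ha
      exact hno j hj (hja.1 h)
    obtain ⟨j, hj, hne⟩ := ht (fun a => G.tail ((G.faceNext ^ a) d)) r hr
      (fun a ha => ⟨⟨fun h => by have := hinj a (by omega) (a + 1) ha h; omega, _, rfl,
        (G.tail_faceNext_pow_succ d a).symm⟩, hno2 a (by omega), hno2 (a + 1) ha⟩) hinj
    have := hcol j hj
    rw [joinColouring_of_notMem _ _ (hno2 j (by omega)),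
      joinColouring_of_notMem _ _ (hno2 (j + r) (by omega))] at this
    exact hne (Fin.natAdd_injective 4 k this)
  have hlist : (List.iterate G.faceNext d (2 * r)).map G.tail =
      (List.range (2 * r)).map fun j => G.tail ((G.faceNext ^ j) d) := by
    rw [← List.range_map_iterate, List.map_map]
    refine List.map_congr_left fun j _ => ?_
    rw [Function.comp_apply, Equiv.Perm.iterate_eq_pow]
  have hnd : ((List.iterate G.faceNext d (2 * r)).map G.tail).Nodup := by
    rw [hlist]
    refine List.Nodup.map_on (fun a ha b hb => ?_) List.nodup_range
    exact hinj a (List.mem_range.1 ha) b (List.mem_range.1 hb)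
  have hsq : ((List.iterate G.faceNext d (2 * r)).map G.tail).map (joinColouring c₀ t) =
      ((List.range r).map fun j => joinColouring c₀ t (G.tail ((G.faceNext ^ j) d))) ++
        (List.range r).map fun j => joinColouring c₀ t (G.tail ((G.faceNext ^ j) d)) := by
    rw [hlist, two_mul, List.range_add, List.map_append, List.map_append, List.map_map,
      List.map_map, List.map_map]
    congr 1
    refine List.map_congr_left fun j hj => ?_
    rw [hcol j (List.mem_range.1 hj), add_comm j r]
    rfl
  have hnonempty : ((List.iterate G.faceNext d (2 * r)).map G.tail).filter
      (fun v => decide (v ∈ B)) ≠ [] := by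
    refine List.ne_nil_of_mem (a := G.tail ((G.faceNext ^ j₀) d)) ?_
    rw [hlist, List.mem_filter]
    exact ⟨List.mem_map.2 ⟨j₀, List.mem_range.2 (by omega), rfl⟩, by simpa using hj₀B⟩
  by_cases hd : d ∈ G.outer
  · rcases exists_blocking_segment_outer (B := B) hd (2 * r) with h | ⟨e, m, he⟩
    · exact hnonempty h
    · exact hnonempty (filter_eq_nil_of_square c₀ t hc₀ hnd hsq he)
  · have hall : ∀ a < 2 * r, G.tail ((G.faceNext ^ a) d) ∈ B := by
      intro a ha
      obtain ⟨i, hi, hia⟩ := hmem2 a ha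
      by_contra h
      exact hG.false_of_mixed_square hB hd hinj hmem hi hj₀ (fun h' => h (hia.2 h')) hj₀B
    have h2 : 2 * r - 2 + 2 = 2 * r := by omega
    -- The path has 2r - 1 edges, all with both ends in `B`, so each of them has the outer face on
    -- its other side.
    obtain ⟨x, -, hx⟩ := exists_blocking_segment_inner (B := B) (n := 2 * r - 2) hd
      (fun i hi => hall i (by omega)) (fun i hi => by
        refine hG.reverse_mem_outer hB (fun h => hd ((pow_mem_outer_iff d i).1 h))
          (hall i (by omega)) ?_
        rw [← tail_faceNext_pow_succ]
        exact hall (i + 1) (by omega))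
    rw [h2] at hx
    refine hnonempty (filter_eq_nil_of_square c₀ t hc₀ hnd hsq (hx.trans ?_))
    symm
    rw [List.filter_eq_self, hlist]
    intro v hv
    obtain ⟨a, ha, rfl⟩ := List.mem_map.1 hv
    simpa using hall a (List.mem_range.1 ha)

theorem IsOuterplane.isFacialNonrepetitive_joinColouring [Finite V] [Finite D]
    (hG : G.IsOuterplane) (hB : G.IsBlockingSet B) {k : ℕ} {c₀ : B → Fin k}
    (hc₀ : (G.blockingGraph B).IsFacialNonrepetitive c₀) {t : V → Fin 4}
    (ht : ∀ (x : ℕ → V) (r : ℕ), 0 < r →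
      (∀ i, i + 1 < 2 * r → (G.avoiding B).Adj (x i) (x (i + 1))) →
      (∀ i < 2 * r, ∀ j < 2 * r, x i = x j → i = j) → ∃ j < r, t (x j) ≠ t (x (j + r))) :
    G.IsFacialNonrepetitive (joinColouring c₀ t) := by
  rintro l ⟨hnd, d, n, rfl⟩
  refine nonrepetitive_of_forall_window fun i r hr hlen => ?_
  simp only [List.length_map, List.length_iterate] at hlen
  have hget : ∀ j < 2 * r, ((List.iterate G.faceNext d n).map G.tail)[i + j]? =
      some (G.tail ((G.faceNext ^ j) ((G.faceNext ^ i) d))) := by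
    intro j hj
    rw [List.getElem?_map, List.getElem?_iterate _ _ _ _ (by omega), Equiv.Perm.iterate_eq_pow,
      add_comm, pow_add]
    rfl
  obtain ⟨j, hj, hne⟩ := hG.exists_joinColouring_ne hB hc₀ ht ((G.faceNext ^ i) d) hr
    fun a ha b hb hab => by
      have h1 : i + a = i + b := (List.getElem?_inj (by simp; omega) hnd).1
        (by rw [hget a ha, hget b hb, hab])
      omega
  refine ⟨j, hj, fun h => hne ?_⟩
  rw [add_assoc, List.getElem?_map, hget j (by omega), List.getElem?_map,
    hget (r + j) (by omega), add_comm r j] at h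
  exact Option.some_injective _ h

end EmbeddedGraph

theorem mainTheorem4 {V D : Type*} [Finite V] [Finite D] (G : EmbeddedGraph V D)
    (hG : G.IsOuterplane) (B : Set V) (hB : G.IsBlockingSet B) (k : ℕ)
    (h : ∃ c : B → Fin k, (G.blockingGraph B).IsFacialNonrepetitive c) :
    ∃ c : V → Fin (k + 4), G.IsFacialNonrepetitive c := by
  obtain ⟨c₀, hc₀⟩ := h
  obtain ⟨t, ht⟩ := hB.isAcyclic_avoiding.exists_nonrepetitive_colouring
  exact ⟨_, hG.isFacialNonrepetitive_joinColouring hB hc₀ ht⟩
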